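/- Theorem 1.1. For $n \in \mathbb{N}$ let $\mathcal{D}_n$ be the finite set of all directed acyclic graphs (DAGs) with vertex set $\{1,\dots,n\}$. The skeleton of $G \in \mathcal{D}_n$ is the undirected graph obtained from $G$ by forgetting the edge directions. A $v$-structure of $G$ is a triple $(a,b,c)$ of vertices with $a \neq b$ such that $a \to c$ and $b \to c$ are edges of $G$ while neither $a \to b$ nor $b \to a$ is an edge of $G$. The Markov equivalence class $M(G)$ is the set of all $G' \in \mathcal{D}_n$ with the same skeleton and the same $v$-structures as $G$. Let $\mathbb{P}_n$ and $\mathbb{E}_n$ denote the law and the expectation for a DAG $G$ chosen uniformly at random from $\mathcal{D}_n$. Put $\alpha = \frac{1}{20}$. There exist constants $C > 0$ and $t_0 \geq 1$ such that for all $n \in \mathbb{N}$ and all real $t \geq t_0$, $$\mathbb{P}_n\big(|M(G)| > t\big) \leq C \exp\big(-(\log t)^{1+\alpha}\big).$$ Consequently, for every $k \in \mathbb{N}$ there exists a constant $c_k > 0$ such that for all $n \in \mathbb{N}$, $$\mathbb{E}_n\big[|M(G)|^k\big] \leq c_k.$$ In particular, the expected size $\mathbb{E}_n[|M(G)|]$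 of the Markov equivalence class is bounded uniformly in $n$. -/

import Mathlib

/-- A directed graph is acyclic if it has no directed closed walk of positive length
(in particular no loops and no pair of opposite edges). -/
def Digraph.IsDirectedAcyclic {V : Type*} (G : Digraph V) : Prop :=
  ∀ v : V, ¬ Relation.TransGen G.Adj v v

/-- The labeled directed acyclic graphs on `n` vertices. -/
def LabeledDAG (n : ℕ) : Type :=
  {G : Digraph (Fin n) // G.IsDirectedAcyclic}

namespace LabeledDAG

/-- The skeleton: the undirected graph obtained by forgetting the edge directions. -/
def skeleton {n : ℕ} (G : LabeledDAG n) : SimpleGraph (Fin n) :=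
  G.val.toSimpleGraphInclusive

/-- The v-structures `(a, b, c)`: distinct non-adjacent `a`, `b` with edges `a → c` and `b → c`. -/
def vStructures {n : ℕ} (G : LabeledDAG n) : Set (Fin n × Fin n × Fin n) :=
  {p | p.1 ≠ p.2.1 ∧ G.val.Adj p.1 p.2.2 ∧ G.val.Adj p.2.1 p.2.2 ∧
    ¬ G.val.Adj p.1 p.2.1 ∧ ¬ G.val.Adj p.2.1 p.1}

/-- The Markov equivalence class of `G`: all DAGs on the same vertices with the same skeleton
and the same v-structures as `G`. -/
def markovClass {n : ℕ} (G : LabeledDAG n) : Set (LabeledDAG n) :=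
  {G' | G'.skeleton = G.skeleton ∧ G'.vStructures = G.vStructures}

/-- The number of elements of the Markov equivalence class of `G`. -/
noncomputable def mecSize {n : ℕ} (G : LabeledDAG n) : ℕ := G.markovClass.ncard

noncomputable instance instFintype (n : ℕ) : Fintype (LabeledDAG n) := by
  classical
  exact (inferInstance : Fintype {G : Digraph (Fin n) // G.IsDirectedAcyclic})

instance instNonempty (n : ℕ) : Nonempty (LabeledDAG n) :=
  ⟨⟨⊥, fun _ h => (Relation.TransGen.head'_iff.1 h).elim fun _ hb => hb.1⟩⟩

instance instMeasurableSpace (n : ℕ) : MeasurableSpace (LabeledDAG n) := ⊤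

instance instDiscreteMeasurableSpace (n : ℕ) : DiscreteMeasurableSpace (LabeledDAG n) :=
  ⟨fun _ => trivial⟩

/-- The law of a uniformly random labeled DAG on `n` vertices. -/
noncomputable def uniformLaw (n : ℕ) : MeasureTheory.Measure (LabeledDAG n) :=
  (PMF.uniformOfFintype (LabeledDAG n)).toMeasure

instance instIsProbabilityMeasure (n : ℕ) : MeasureTheory.IsProbabilityMeasure (uniformLaw n) :=
  PMF.toMeasure.isProbabilityMeasure _

end LabeledDAG

/-! ### Markov equivalence: reversible edges and dominated vertices -/

namespace LabeledDAG

variable {n : ℕ} {G G' : LabeledDAG n}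

/-! A deterministic bound for the class in terms of the number d of dominated vertices is combined
with a tail bound for d.

Deterministic part. If an edge into v is reversed in some equivalent DAG, preservation of
v-structures forces v to have a parent whose parents include all other parents of v
(`exists_mem_forall_adj`). So heads of reversible edges are dominated, and the undominated tails
inject into the heads: reversible edges have at most 2d end points (`ncard_reversibleVertices_le`).
A member of the class is determined by ancestor counts on these end points, whence |M(G)| ≤
(2d)^(2d) (`mecSize_le_pow`).

Probabilistic part. Given the height function, the parent sets are independent, and each is uniform
on at least half of the subsets of the lower layers (`exists_of_mem_parentFunctions`,
`le_two_mul_card_parentSets`). A vertex with r vertices in lower layers is then dominated by a given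
lower vertex with probability O((3/4)^r) (`sum_mul_dominates_le`). Layers are rarely large:
splitting a layer of size g into two multiplies the number of DAGs by about 2^(cg²), which gives
Gaussian tails (`card_le_layer_le`). So, up to probability O((24/25)^(q^6)), a layer above r
vertices has size at most √(q^6 + r). In that case q^5 dominated vertices force one of three
configurations: one of very high rank, a large star above one dominating vertex, or q disjoint
dominating pairs of rank at least q^5/4 (`Tame.exists_of_le_card_dominatedSet`). Each has
probability O((24/25)^(q^6)).

Thus d ≥ q^5 has probability exp(-Ω(q^6)), while d ≤ q^5 gives log|M(G)| = O(q^5 log q). Since 6/5 >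
1 + 1/20, the tail bound follows. It decays faster than every power of t, so all moments are
bounded. -/

theorem not_adj_self (G : LabeledDAG n) (a : Fin n) : ¬ G.val.Adj a a :=
  fun h => G.property a (.single h)

theorem adj_asymm {a b : Fin n} (h : G.val.Adj a b) : ¬ G.val.Adj b a :=
  fun h' => G.property a (.tail (.single h) h')

theorem not_adj_of_adj_adj {a b c : Fin n} (h : G.val.Adj a b) (h' : G.val.Adj b c) :
    ¬ G.val.Adj c a :=
  fun h'' => G.property a (.tail (.tail (.single h) h') h'')

theorem adj_ne {a b : Fin n} (h : G.val.Adj a b) : a ≠ b :=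
  fun e => G.not_adj_self a (e ▸ h)

theorem wellFounded_adj (G : LabeledDAG n) : WellFounded G.val.Adj := by
  have : Std.Irrefl (Relation.TransGen G.val.Adj) := ⟨G.property⟩
  have h : WellFounded (Relation.TransGen G.val.Adj) := Finite.wellFounded_of_trans_of_irrefl _
  exact Subrelation.wf (fun h => Relation.TransGen.single h) h

open Classical in
/-- The height of a vertex: the length of a longest directed path ending there. -/
noncomputable def height (G : LabeledDAG n) : Fin n → ℕ :=
  G.wellFounded_adj.fix fun v f => Finset.univ.sup fun u =>
    if h : G.val.Adj u v then f u h + 1 else 0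

open Classical in
theorem height_eq (G : LabeledDAG n) (v : Fin n) :
    G.height v = Finset.univ.sup fun u => if G.val.Adj u v then G.height u + 1 else 0 := by
  rw [height, WellFounded.fix_eq]
  simp only [dite_eq_ite]

theorem height_lt {u v : Fin n} (h : G.val.Adj u v) : G.height u < G.height v := by
  classical
  rw [G.height_eq v]
  refine lt_of_lt_of_le (Nat.lt_succ_self _) ?_
  refine le_trans ?_ (Finset.le_sup (Finset.mem_univ u))
  simp [h]

theorem exists_adj_height {v : Fin n} (h : 0 < G.height v) :
    ∃ u, G.val.Adj u v ∧ G.height u + 1 = G.height v := by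
  classical
  have hne : (Finset.univ : Finset (Fin n)).Nonempty := ⟨v, Finset.mem_univ v⟩
  obtain ⟨u, -, hu⟩ := Finset.exists_mem_eq_sup Finset.univ hne
    (fun u => if G.val.Adj u v then G.height u + 1 else 0)
  rw [← G.height_eq v] at hu
  by_cases hA : G.val.Adj u v
  · exact ⟨u, hA, by simpa [hA] using hu.symm⟩
  · simp [hA] at hu; omega

theorem markovClass_symm (h : G' ∈ G.markovClass) : G ∈ G'.markovClass :=
  ⟨h.1.symm, h.2.symm⟩

theorem markovClass_adj (h : G' ∈ G.markovClass) {a b : Fin n} (hab : G.val.Adj a b) :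
    G'.val.Adj a b ∨ G'.val.Adj b a := by
  have h1 : G.skeleton.Adj a b := ⟨adj_ne hab, Or.inl hab⟩
  rw [← h.1] at h1
  exact h1.2

/-- Two vertices are joined by an edge in some direction. -/
def Joined (G : LabeledDAG n) (a b : Fin n) : Prop := G.val.Adj a b ∨ G.val.Adj b a

theorem Joined.symm {a b : Fin n} (h : G.Joined a b) : G.Joined b a := Or.symm h

theorem joined_of_markovClass (h : G' ∈ G.markovClass) {a b : Fin n} (hab : G.Joined a b) :
    G'.Joined a b :=
  hab.elim (markovClass_adj h) fun h' => (markovClass_adj h h').symm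

theorem joined_iff (h : G' ∈ G.markovClass) {a b : Fin n} : G'.Joined a b ↔ G.Joined a b :=
  ⟨joined_of_markovClass (markovClass_symm h), joined_of_markovClass h⟩

theorem adj_of_vStructure (h : G' ∈ G.markovClass) {a b c : Fin n} (hne : a ≠ b)
    (hac : G.val.Adj a c) (hbc : G.val.Adj b c) (hab : ¬ G.Joined a b) :
    G'.val.Adj a c ∧ G'.val.Adj b c := by
  have h1 : (a, b, c) ∈ G.vStructures :=
    ⟨hne, hac, hbc, fun h => hab (.inl h), fun h => hab (.inr h)⟩
  rw [← h.2] at h1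
  exact ⟨h1.2.1, h1.2.2.1⟩

theorem Joined.adj_of_path {a b c : Fin n} (h : G.Joined a c) (hab : G.val.Adj a b)
    (hbc : G.val.Adj b c) : G.val.Adj a c :=
  h.elim id fun h' => absurd h' (not_adj_of_adj_adj hab hbc)

/-- If `u₀ → v` is reversed in a Markov equivalent DAG, every set of parents of `v` containing `u₀`
has an element whose parents include all the other ones. -/
theorem exists_mem_forall_adj (h : G' ∈ G.markovClass) {u₀ v : Fin n} (huv : G.val.Adj u₀ v)
    (hvu : G'.val.Adj v u₀) (A : Set (Fin n)) (hA : ∀ a ∈ A, G.val.Adj a v) (hu₀ : u₀ ∈ A) :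
    ∃ u ∈ A, ∀ w ∈ A, w ≠ u → G.val.Adj w u := by
  classical
  have hj : ∀ w ∈ A, w ≠ u₀ → G.Joined w u₀ := by
    intro w hw hne
    by_contra hn
    exact adj_asymm hvu (adj_of_vStructure h hne (hA w hw) huv hn).2
  -- The required element is the highest one among u₀ and its children in A.
  obtain ⟨u, hu, hmax⟩ := Finset.exists_max_image
    (Finset.univ.filter fun w => w ∈ A ∧ (w = u₀ ∨ G.val.Adj u₀ w)) G.height
    ⟨u₀, by simp [hu₀]⟩
  simp only [Finset.mem_filter, Finset.mem_univ, true_and] at hu hmax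
  obtain ⟨huA, hu⟩ := hu
  refine ⟨u, huA, fun w hw hne => ?_⟩
  have hwu : G.Joined w u := by
    by_contra hn
    have h1 := adj_of_vStructure h hne (hA w hw) (hA u huA) hn
    rcases hu with rfl | hu
    · exact adj_asymm hvu h1.2
    -- In G' both w and u point to v and v points to u₀, so acyclicity gives w → u₀ ← u. This
    -- v-structure also lies in G, against u₀ → u.
    · have hw0 : w ≠ u₀ := fun e => hn (.inl (e ▸ hu))
      have h2 := (joined_of_markovClass h (hj w hw hw0)).adj_of_path h1.1 hvu
      have h3 := (joined_of_markovClass h (.inr hu : G.Joined u u₀)).adj_of_path h1.2 hvu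
      exact adj_asymm hu
        (adj_of_vStructure (markovClass_symm h) hne h2 h3 (mt (joined_iff h).1 hn)).2
  refine hwu.resolve_right fun huw => ?_
  have hw0 : w ≠ u₀ := by
    rintro rfl
    rcases hu with rfl | hu
    · exact hne rfl
    · exact adj_asymm hu huw
  have h0w : G.val.Adj u₀ w := by
    rcases hu with rfl | hu
    · exact huw
    · exact (hj w hw hw0).symm.adj_of_path hu huw
  exact absurd (hmax w ⟨hw, .inr h0w⟩) (not_le.2 (height_lt huw))

/-- The vertices `v` with a parent `u` such that all other parents of `v` are parents of `u`. -/
def dominatedVertices (G : LabeledDAG n) : Set (Fin n) :=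
  {v | ∃ u, G.val.Adj u v ∧ ∀ w, G.val.Adj w v → w ≠ u → G.val.Adj w u}

theorem mem_dominatedVertices_of_reversed (h : G' ∈ G.markovClass) {u v : Fin n}
    (huv : G.val.Adj u v) (hvu : G'.val.Adj v u) : v ∈ G.dominatedVertices := by
  obtain ⟨w, hw, hw'⟩ := exists_mem_forall_adj h huv hvu {a | G.val.Adj a v} (fun _ => id) huv
  exact ⟨w, hw, hw'⟩

/-- Of two adjacent parents of `v` on reversible edges, the later one is dominated. -/
theorem mem_dominatedVertices_of_adj (h : G' ∈ G.markovClass) {s s' v : Fin n}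
    (hss : G.val.Adj s s') (hsv : G.val.Adj s v) (hs'v : G.val.Adj s' v)
    (hvs : G'.val.Adj v s) : s' ∈ G.dominatedVertices := by
  -- If all parents of s' are joined to v, they are parents of v, and `exists_mem_forall_adj`
  -- applies to the set of parents of s', which contains s. Otherwise some edge into s' turns out to
  -- be reversed in G'.
  by_cases hp : ∀ w, G.val.Adj w s' → G.Joined w v
  · obtain ⟨u, hu, hu'⟩ := exists_mem_forall_adj h hsv hvs {a | G.val.Adj a s'}
      (fun w hw => (hp w hw).adj_of_path hw hs'v) hss
    exact ⟨u, hu, hu'⟩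
  · push Not at hp
    obtain ⟨w, hw, hwv⟩ := hp
    rcases markovClass_adj h hss with h1 | h1
    · have h2 := (joined_of_markovClass h (.inr hs'v : G.Joined v s')).adj_of_path hvs h1
      rcases markovClass_adj h hw with h3 | h3
      · have hne : w ≠ v := fun e => adj_asymm hs'v (e ▸ hw)
        exact absurd (adj_of_vStructure (markovClass_symm h) hne h3 h2
          (mt (joined_iff h).1 hwv)).2 (adj_asymm hs'v)
      · exact mem_dominatedVertices_of_reversed h hw h3
    · exact mem_dominatedVertices_of_reversed h hss h1

/-- The edge `u → v` points the other way in some Markov equivalent DAG. -/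
def Reversible (G : LabeledDAG n) (u v : Fin n) : Prop :=
  G.val.Adj u v ∧ ∃ G' ∈ G.markovClass, G'.val.Adj v u

/-- The end points of reversible edges. -/
def reversibleVertices (G : LabeledDAG n) : Set (Fin n) :=
  {v | ∃ u, G.Reversible u v ∨ G.Reversible v u}

/-- Heads of reversible edges are dominated, so an undominated end point is a tail. Two undominated
tails cannot share a head: if adjacent, the later one would be dominated; if not, they form a
v-structure, which fixes both edges. -/
theorem ncard_reversibleVertices_le (G : LabeledDAG n) :
    G.reversibleVertices.ncard ≤ 2 * G.dominatedVertices.ncard := by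
  classical
  have hch : ∀ s ∈ G.reversibleVertices \ G.dominatedVertices, ∃ v, G.Reversible s v := by
    rintro s ⟨⟨u, hu | hu⟩, hs⟩
    · obtain ⟨h1, G', h2, h3⟩ := hu
      exact absurd (mem_dominatedVertices_of_reversed h2 h1 h3) hs
    · exact ⟨u, hu⟩
  choose! f hf using hch
  have h1 : (G.reversibleVertices \ G.dominatedVertices).ncard ≤ G.dominatedVertices.ncard := by
    refine Set.ncard_le_ncard_of_injOn f (fun s hs => ?_) (fun s hs s' hs' e => ?_)
    · obtain ⟨h1, G', h2, h3⟩ := hf s hs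
      exact mem_dominatedVertices_of_reversed h2 h1 h3
    · by_contra hne
      obtain ⟨h1, G₁, h2, h3⟩ := hf s hs
      obtain ⟨h1', G₂, h2', h3'⟩ := hf s' hs'
      rw [← e] at h1' h3'
      by_cases hj : G.Joined s s'
      · rcases hj with hj | hj
        · exact hs'.2 (mem_dominatedVertices_of_adj h2 hj h1 h1' h3)
        · exact hs.2 (mem_dominatedVertices_of_adj h2' hj h1' h1 h3')
      · exact adj_asymm h3 (adj_of_vStructure h2 hne h1 h1' hj).1
  have h2 := Set.ncard_le_ncard_sdiff_add_ncard G.reversibleVertices G.dominatedVertices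
  omega

/-- The number of ancestors of a vertex inside a set. -/
noncomputable def ancestorCount (G : LabeledDAG n) (U : Set (Fin n)) (v : Fin n) : ℕ :=
  {u ∈ U | Relation.TransGen G.val.Adj u v}.ncard

theorem ancestorCount_lt_ncard (G : LabeledDAG n) {U : Set (Fin n)} {v : Fin n} (hv : v ∈ U) :
    G.ancestorCount U v < U.ncard := by
  refine Set.ncard_lt_ncard ⟨fun x hx => hx.1, fun h => ?_⟩
  exact G.property v (h hv).2

theorem ancestorCount_lt {U : Set (Fin n)} {u v : Fin n} (hu : u ∈ U) (h : G.val.Adj u v) :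
    G.ancestorCount U u < G.ancestorCount U v := by
  refine Set.ncard_lt_ncard ⟨fun x hx => ⟨hx.1, hx.2.tail h⟩, fun hle => ?_⟩
  have : u ∈ {x ∈ U | Relation.TransGen G.val.Adj x v} := ⟨hu, .single h⟩
  exact G.property u (hle this).2

theorem ext_adj {G H : LabeledDAG n} (h : ∀ a b, G.val.Adj a b → H.val.Adj a b)
    (h' : ∀ a b, H.val.Adj a b → G.val.Adj a b) : G = H :=
  Subtype.ext (Digraph.ext (by ext a b; exact ⟨h a b, h' a b⟩))

/-- Edges on which two members of the class disagree have both ends in U, and their direction can be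
read off from the numbers of ancestors in U, which increase strictly along such edges. -/
theorem mecSize_le_pow (G : LabeledDAG n) :
    G.mecSize ≤ (2 * G.dominatedVertices.ncard) ^ (2 * G.dominatedVertices.ncard) := by
  classical
  set U := G.reversibleVertices with hU
  have hinj : ∀ H₁ ∈ G.markovClass, ∀ H₂ ∈ G.markovClass,
      (∀ v ∈ U, H₁.ancestorCount U v = H₂.ancestorCount U v) →
      ∀ a b, H₁.val.Adj a b → H₂.val.Adj a b := by
    intro H₁ h₁ H₂ h₂ e a b hab
    have hj : G.Joined a b := (joined_iff h₁).1 (.inl hab)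
    rcases (joined_iff h₂).2 hj with h | h
    · exact h
    · have hab' : a ∈ U ∧ b ∈ U := by
        rcases hj with hj | hj
        · have : G.Reversible a b := ⟨hj, H₂, h₂, h⟩
          exact ⟨⟨b, .inr this⟩, ⟨a, .inl this⟩⟩
        · have : G.Reversible b a := ⟨hj, H₁, h₁, hab⟩
          exact ⟨⟨b, .inl this⟩, ⟨a, .inr this⟩⟩
      have h3 := ancestorCount_lt hab'.1 hab
      have h4 := ancestorCount_lt hab'.2 h
      rw [e _ hab'.1, e _ hab'.2] at h3
      omega
  let F : LabeledDAG n → (U → Fin U.ncard) := fun H v =>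
    ⟨H.ancestorCount U v, H.ancestorCount_lt_ncard v.2⟩
  have hF : Set.InjOn F G.markovClass := by
    intro H₁ h₁ H₂ h₂ e
    have e' : ∀ v ∈ U, H₁.ancestorCount U v = H₂.ancestorCount U v := fun v hv =>
      congrArg Fin.val (congrFun e ⟨v, hv⟩)
    exact ext_adj (hinj H₁ h₁ H₂ h₂ e') (hinj H₂ h₂ H₁ h₁ fun v hv => (e' v hv).symm)
  have h1 : G.mecSize ≤ U.ncard ^ U.ncard := by
    have := Set.ncard_le_ncard_of_injOn F (t := Set.univ) (fun _ _ => Set.mem_univ _) hF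
    rw [Set.ncard_univ, Nat.card_fun, Nat.card_eq_fintype_card, Fintype.card_fin,
      Nat.card_coe_set_eq] at this
    exact this
  -- For empty U the bound is 0 ^ 0 = 1, so it suffices that the right-hand side is nonzero; this
  -- includes the case where it is again 0 ^ 0.
  rcases Nat.eq_zero_or_pos U.ncard with h0 | h0
  · rw [h0] at h1
    refine h1.trans (Nat.one_le_iff_ne_zero.2 ?_)
    rcases Nat.eq_zero_or_pos (2 * G.dominatedVertices.ncard) with h | h
    · simp [h]
    · positivity
  · have h2 := ncard_reversibleVertices_le G
    exact h1.trans ((Nat.pow_le_pow_right h0 h2).trans (Nat.pow_le_pow_left h2 _))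

end LabeledDAG

/-! ### Counting DAGs with a given height function -/

namespace LabeledDAG

variable {n : ℕ}

/-- The number of vertices of level less than `i`. -/
def cumul (l : Fin n → ℕ) (i : ℕ) : ℕ := (Finset.univ.filter fun u => l u < i).card

/-- The number of vertices of level `i`. -/
def layer (l : Fin n → ℕ) (i : ℕ) : ℕ := (Finset.univ.filter fun u => l u = i).card

theorem cumul_zero (l : Fin n → ℕ) : cumul l 0 = 0 := by simp [cumul]

theorem cumul_succ (l : Fin n → ℕ) (i : ℕ) : cumul l (i + 1) = cumul l i + layer l i := by
  rw [cumul, cumul, layer, ← Finset.card_union_of_disjoint]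
  · congr 1
    ext u
    simp only [Finset.mem_filter, Finset.mem_univ, true_and, Finset.mem_union]
    omega
  · refine Finset.disjoint_filter.2 fun u _ h => ?_
    omega

theorem cumul_mono (l : Fin n → ℕ) : Monotone (cumul l) := fun i j h =>
  Finset.card_le_card fun u hu => by
    simp only [Finset.mem_filter, Finset.mem_univ, true_and] at hu ⊢
    omega

theorem layer_pos (l : Fin n → ℕ) (v : Fin n) : 0 < layer l (l v) :=
  Finset.card_pos.2 ⟨v, by simp⟩

/-- The possible parent sets of a vertex of height `i` when the heights of all vertices are given
by `l`. -/
def parentSets (l : Fin n → ℕ) (i : ℕ) : Finset (Finset (Fin n)) :=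
  (Finset.univ.filter fun u => l u < i).powerset.filter fun a => 0 < i → ∃ u ∈ a, l u + 1 = i

theorem mem_parentSets {l : Fin n → ℕ} {i : ℕ} {a : Finset (Fin n)} :
    a ∈ parentSets l i ↔ (∀ u ∈ a, l u < i) ∧ (0 < i → ∃ u ∈ a, l u + 1 = i) := by
  simp [parentSets, Finset.subset_iff]

theorem card_parentSets_zero (l : Fin n → ℕ) : (parentSets l 0).card = 1 := by
  simp [parentSets]

/-- The excluded sets are those that miss level `i`, that is, the subsets of the levels below `i`.
-/
theorem card_parentSets_succ (l : Fin n → ℕ) (i : ℕ) :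
    (parentSets l (i + 1)).card + 2 ^ cumul l i = 2 ^ cumul l (i + 1) := by
  have h := Finset.card_filter_add_card_filter_not
    (s := (Finset.univ.filter fun u => l u < i + 1).powerset)
    (fun a : Finset (Fin n) => 0 < i + 1 → ∃ u ∈ a, l u + 1 = i + 1)
  rw [Finset.card_powerset] at h
  rw [cumul, cumul, ← h, parentSets, ← Finset.card_powerset]
  congr 2
  ext a
  simp only [Finset.mem_powerset, Finset.mem_filter, Finset.subset_iff, Finset.mem_univ, true_and,
    Nat.succ_pos, forall_true_left, not_exists, not_and, add_left_inj]
  constructor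
  · exact fun h => ⟨fun u hu => Nat.lt_succ_of_lt (h hu), fun u hu => (h hu).ne⟩
  · exact fun h u hu => lt_of_le_of_ne (Nat.lt_succ_iff.1 (h.1 hu)) (h.2 u hu)

theorem card_parentSets_le (l : Fin n → ℕ) (i : ℕ) :
    (parentSets l i).card ≤ 2 ^ cumul l i := by
  cases i with
  | zero => simp [card_parentSets_zero, cumul_zero]
  | succ i => exact (Nat.le_add_right _ _).trans (card_parentSets_succ l i).le

/-- If all levels below `i` are occupied, at least half of the sets of vertices below level `i` are
possible parent sets. -/
theorem le_two_mul_card_parentSets {l : Fin n → ℕ} {i : ℕ} (h : ∀ j < i, 0 < layer l j) :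
    2 ^ cumul l i ≤ 2 * (parentSets l i).card := by
  cases i with
  | zero => simp [card_parentSets_zero, cumul_zero]
  | succ i =>
    have h1 := card_parentSets_succ l i
    have h2 := cumul_succ l i
    have h3 : 2 * 2 ^ cumul l i ≤ 2 ^ cumul l (i + 1) := by
      rw [← pow_succ']
      exact Nat.pow_le_pow_right two_pos (by have := h i (Nat.lt_succ_self i); omega)
    omega

/-- The possible parent functions of DAGs with height function `l`. -/
def parentFunctions (l : Fin n → ℕ) : Finset (Fin n → Finset (Fin n)) :=
  Fintype.piFinset fun v => parentSets l (l v)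

open Classical in
/-- The parent sets of a DAG. -/
noncomputable def parents (G : LabeledDAG n) (v : Fin n) : Finset (Fin n) :=
  Finset.univ.filter fun u => G.val.Adj u v

theorem mem_parents {G : LabeledDAG n} {u v : Fin n} : u ∈ G.parents v ↔ G.val.Adj u v := by
  simp [parents]

theorem parents_injective : Function.Injective (parents : LabeledDAG n → _) := by
  intro G H h
  have h' : ∀ a b, G.val.Adj a b ↔ H.val.Adj a b := fun a b => by
    rw [← mem_parents, ← mem_parents, h]
  exact ext_adj (fun a b => (h' a b).1) (fun a b => (h' a b).2)

theorem parents_mem_parentFunctions (G : LabeledDAG n) :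
    G.parents ∈ parentFunctions G.height := by
  refine Fintype.mem_piFinset.2 fun v => mem_parentSets.2 ⟨fun u hu => ?_, fun h => ?_⟩
  · exact height_lt (mem_parents.1 hu)
  · obtain ⟨u, hu, hu'⟩ := exists_adj_height h
    exact ⟨u, mem_parents.2 hu, hu'⟩

/-- With `parents_injective` and `parents_mem_parentFunctions` this identifies the DAGs of height
function `l` with a product set: given the heights, the parent sets are independent. The mandatory
parent one level below is what makes the height reach `l`. -/
theorem exists_of_mem_parentFunctions {l : Fin n → ℕ} {x : Fin n → Finset (Fin n)}
    (hx : x ∈ parentFunctions l) : ∃ G : LabeledDAG n, G.height = l ∧ G.parents = x := by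
  classical
  have hx' := fun v => mem_parentSets.1 (Fintype.mem_piFinset.1 hx v)
  have hmono : ∀ u v, Relation.TransGen (fun u v => u ∈ x v) u v → l u < l v := by
    intro u v h
    induction h with
    | single h => exact (hx' _).1 _ h
    | tail _ h ih => exact ih.trans ((hx' _).1 _ h)
  let G : LabeledDAG n := ⟨⟨fun u v => u ∈ x v⟩, fun v h => lt_irrefl _ (hmono v v h)⟩
  refine ⟨G, ?_, ?_⟩
  · funext v
    induction hk : l v using Nat.strong_induction_on generalizing v with
    | _ k ih =>
      have hih : ∀ u, l u < l v → G.height u = l u := fun u hu => ih _ (hk ▸ hu) u rfl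
      refine le_antisymm ?_ ?_
      · by_contra! hlt
        obtain ⟨u, hu, hu'⟩ := exists_adj_height (lt_of_le_of_lt (Nat.zero_le _) hlt)
        have h1 : l u < l v := (hx' v).1 u hu
        rw [hih u h1] at hu'
        omega
      · rcases Nat.eq_zero_or_pos k with h0 | h0
        · omega
        · obtain ⟨u, hu, hu'⟩ := (hx' v).2 (hk ▸ h0)
          have h1 := hih u (by omega)
          have h2 : G.height u < G.height v := height_lt (G := G) hu
          omega
  · funext v
    ext u
    exact mem_parents

open Classical in
theorem card_filter_height_eq (l : Fin n → ℕ) (P : (Fin n → Finset (Fin n)) → Prop) :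
    (Finset.univ.filter fun G : LabeledDAG n => G.height = l ∧ P G.parents).card =
      ((parentFunctions l).filter P).card := by
  refine Finset.card_bij (fun G _ => G.parents) ?_ ?_ ?_
  · intro G hG
    simp only [Finset.mem_filter, Finset.mem_univ, true_and] at hG ⊢
    exact ⟨hG.1 ▸ parents_mem_parentFunctions G, hG.2⟩
  · exact fun G _ H _ h => parents_injective h
  · intro x hx
    rw [Finset.mem_filter] at hx
    obtain ⟨G, hG, rfl⟩ := exists_of_mem_parentFunctions hx.1
    exact ⟨G, by simpa using ⟨hG, hx.2⟩, rfl⟩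

open Classical in
theorem card_height_eq (l : Fin n → ℕ) :
    (Finset.univ.filter fun G : LabeledDAG n => G.height = l).card =
      (parentFunctions l).card := by
  simpa using card_filter_height_eq l fun _ => True

theorem card_parentFunctions (l : Fin n → ℕ) :
    (parentFunctions l).card = ∏ v, (parentSets l (l v)).card :=
  Fintype.card_piFinset _

theorem layer_height_pos (G : LabeledDAG n) {v : Fin n} {j : ℕ} (hj : j ≤ G.height v) :
    0 < layer G.height j := by
  induction hk : G.height v generalizing v with
  | zero =>
    obtain rfl : j = G.height v := by omega
    exact layer_pos _ v
  | succ k ih =>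
    rcases hj.eq_or_lt with rfl | h
    · exact layer_pos _ v
    · obtain ⟨u, -, hu⟩ := exists_adj_height (G := G) (v := v) (by omega)
      exact ih (v := u) (by omega) (by omega)

theorem le_cumul {l : Fin n → ℕ} {i : ℕ} (h : ∀ j < i, 0 < layer l j) : i ≤ cumul l i := by
  induction i with
  | zero => exact Nat.zero_le _
  | succ i ih =>
    have h1 := ih fun j hj => h j (by omega)
    have h2 := h i (by omega)
    rw [cumul_succ]
    omega

open Classical in
/-- Comparison of DAG counts through an injective change of the height function. -/
theorem card_height_le_of_injOn (P : (Fin n → ℕ) → Prop) (f : (Fin n → ℕ) → Fin n → ℕ) (κ : ℝ)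
    (hκ : 0 ≤ κ) (hf : Set.InjOn f {l | P l})
    (h : ∀ l, P l → ((parentFunctions l).card : ℝ) ≤ κ * (parentFunctions (f l)).card) :
    ((Finset.univ.filter fun G : LabeledDAG n => P G.height).card : ℝ) ≤
      κ * Fintype.card (LabeledDAG n) := by
  set T := Finset.univ.filter fun G : LabeledDAG n => P G.height
  set L := T.image height
  have hL : ∀ l ∈ L, P l := by
    intro l hl
    obtain ⟨G, hG, rfl⟩ := Finset.mem_image.1 hl
    exact (Finset.mem_filter.1 hG).2
  have h1 : T.card = ∑ l ∈ L, (parentFunctions l).card := by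
    rw [Finset.card_eq_sum_card_image height T]
    refine Finset.sum_congr rfl fun l hl => ?_
    rw [← card_height_eq]
    congr 1
    ext G
    simp only [T, Finset.mem_filter, Finset.mem_univ, true_and, and_iff_right_iff_imp]
    rintro rfl
    exact hL _ hl
  have h2 : ∑ l ∈ L, (parentFunctions (f l)).card ≤ Fintype.card (LabeledDAG n) := by
    rw [← Finset.sum_image (f := fun l => (parentFunctions l).card) (g := f)
      fun a ha b hb e => hf (hL a ha) (hL b hb) e]
    simp_rw [← card_height_eq]
    have h3 := Finset.card_eq_sum_card_fiberwise (s := Finset.univ.filter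
      fun G : LabeledDAG n => G.height ∈ L.image f) (f := height) (t := L.image f)
      fun G hG => (Finset.mem_filter.1 hG).2
    refine le_trans (le_of_eq ?_) (h3.symm.le.trans (Finset.card_le_univ _))
    refine Finset.sum_congr rfl fun l hl => ?_
    congr 1
    ext G
    simp only [Finset.mem_filter, Finset.mem_univ, true_and, iff_and_self]
    rintro rfl
    exact hl
  calc (T.card : ℝ) = ∑ l ∈ L, ((parentFunctions l).card : ℝ) := by rw [h1]; push_cast; rfl
    _ ≤ ∑ l ∈ L, κ * ((parentFunctions (f l)).card : ℝ) :=
      Finset.sum_le_sum fun l hl => h l (hL l hl)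
    _ = κ * ((∑ l ∈ L, (parentFunctions (f l)).card : ℕ) : ℝ) := by
      rw [← Finset.mul_sum]; push_cast; rfl
    _ ≤ _ := mul_le_mul_of_nonneg_left (by exact_mod_cast h2) hκ

end LabeledDAG

/-! ### Splitting a layer: Gaussian tails for layer sizes -/

namespace LabeledDAG

variable {n : ℕ}

/-- Lift by one all vertices of level at least `i` that are not in `B`. -/
def splitLevel (i : ℕ) (B : Finset (Fin n)) (l : Fin n → ℕ) (v : Fin n) : ℕ :=
  if l v < i ∨ v ∈ B then l v else l v + 1

section Split

variable {i a b : ℕ} {B : Finset (Fin n)} {l : Fin n → ℕ}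

/-- The recovery formula does not involve `B`, so splitting is injective in `l` even when `B` is
chosen depending on `l`. -/
theorem eq_of_splitLevel (hB : ∀ v ∈ B, l v = i) (v : Fin n) :
    l v = if splitLevel i B l v ≤ i then splitLevel i B l v else splitLevel i B l v - 1 := by
  have := hB v
  by_cases h : v ∈ B
  · simp [splitLevel, h, this h]
  · simp only [splitLevel, h, or_false]
    split_ifs <;> omega

theorem cumul_splitLevel_of_le (hB : ∀ v ∈ B, l v = i) {j : ℕ} (hj : j ≤ i) :
    cumul (splitLevel i B l) j = cumul l j := by
  unfold cumul
  congr 1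
  ext v
  have := eq_of_splitLevel hB v
  simp only [Finset.mem_filter, Finset.mem_univ, true_and]
  split_ifs at this <;> omega

theorem cumul_splitLevel_succ (hB : ∀ v ∈ B, l v = i) (hb : B.card = b) :
    cumul (splitLevel i B l) (i + 1) = cumul l i + b := by
  rw [cumul, cumul, ← hb, ← Finset.card_union_of_disjoint]
  · congr 1
    ext v
    have := hB v
    simp only [Finset.mem_filter, Finset.mem_univ, true_and, Finset.mem_union]
    by_cases h : v ∈ B
    · simp [splitLevel, h, this h]
    · simp only [splitLevel, h, or_false]
      split_ifs <;> omega
  · refine Finset.disjoint_left.2 fun v hv hv' => ?_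
    have := hB v hv'
    simp at hv
    omega

theorem cumul_splitLevel_of_gt (hB : ∀ v ∈ B, l v = i) {j : ℕ} (hj : i < j) :
    cumul (splitLevel i B l) (j + 1) = cumul l j := by
  unfold cumul
  congr 1
  ext v
  have := hB v
  simp only [Finset.mem_filter, Finset.mem_univ, true_and]
  by_cases h : v ∈ B
  · simp [splitLevel, h, this h]; omega
  · simp only [splitLevel, h, or_false]
    split_ifs <;> omega

theorem card_parentSets_congr {l l' : Fin n → ℕ} {i j : ℕ}
    (h : cumul l (i + 1) = cumul l' (j + 1)) (h' : cumul l i = cumul l' j) :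
    (parentSets l (i + 1)).card = (parentSets l' (j + 1)).card := by
  have h1 := card_parentSets_succ l i
  have h2 := card_parentSets_succ l' j
  rw [h, h'] at h1
  omega

theorem card_parentSets_splitLevel_of_le (hB : ∀ v ∈ B, l v = i) {j : ℕ} (hj : j ≤ i) :
    (parentSets (splitLevel i B l) j).card = (parentSets l j).card := by
  cases j with
  | zero => rw [card_parentSets_zero, card_parentSets_zero]
  | succ j =>
    exact card_parentSets_congr (cumul_splitLevel_of_le hB hj)
      (cumul_splitLevel_of_le hB (by omega))

/-- A lifted vertex of level `i` may take any nonempty subset of `B` in addition to any set of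
vertices below level `i`. -/
theorem le_card_parentSets_splitLevel (hB : ∀ v ∈ B, l v = i) (hb : B.card = b) :
    (2 ^ b - 1 : ℝ) * (parentSets l i).card ≤ (parentSets (splitLevel i B l) (i + 1)).card := by
  have h1 := card_parentSets_succ (splitLevel i B l) i
  rw [cumul_splitLevel_succ hB hb, cumul_splitLevel_of_le hB le_rfl, pow_add] at h1
  have h1' : ((parentSets (splitLevel i B l) (i + 1)).card : ℝ) + 2 ^ cumul l i =
    2 ^ cumul l i * 2 ^ b := by exact_mod_cast h1
  have h2 : ((parentSets l i).card : ℝ) ≤ 2 ^ cumul l i := by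
    exact_mod_cast card_parentSets_le l i
  have h3 : (1 : ℝ) ≤ 2 ^ b := one_le_pow₀ one_le_two
  nlinarith

/-- The mandatory parent of a vertex just above the split layer must now lie among the `a` lifted
vertices; a proportion `2 ^ (-a)` of all subsets misses them. -/
theorem le_card_parentSets_splitLevel_succ (hB : ∀ v ∈ B, l v = i) (hb : B.card = b)
    (ha : layer l i = b + a) :
    (1 - (1 / 2) ^ a : ℝ) * (parentSets l (i + 1)).card ≤
      (parentSets (splitLevel i B l) (i + 2)).card := by
  have h1 := card_parentSets_succ (splitLevel i B l) (i + 1)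
  rw [cumul_splitLevel_succ hB hb, cumul_splitLevel_of_gt hB (Nat.lt_succ_self i), cumul_succ,
    ha] at h1
  have h2 := card_parentSets_le l (i + 1)
  rw [cumul_succ, ha] at h2
  have h1' : ((parentSets (splitLevel i B l) (i + 2)).card : ℝ) + 2 ^ (cumul l i + b) =
    2 ^ (cumul l i + (b + a)) := by exact_mod_cast h1
  have h2' : ((parentSets l (i + 1)).card : ℝ) ≤ 2 ^ (cumul l i + (b + a)) := by
    exact_mod_cast h2
  have h3 : ((1 : ℝ) / 2) ^ a * 2 ^ (cumul l i + (b + a)) = 2 ^ (cumul l i + b) := by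
    rw [← add_assoc, pow_add _ _ a, mul_comm, mul_assoc, ← mul_pow]
    norm_num
  have h4 : (0 : ℝ) ≤ 1 - (1 / 2) ^ a :=
    sub_nonneg.2 (pow_le_one₀ (by norm_num) (by norm_num))
  nlinarith [mul_le_mul_of_nonneg_left h2' h4]

theorem card_parentSets_splitLevel_of_gt (hB : ∀ v ∈ B, l v = i) {j : ℕ} (hj : i + 1 < j) :
    (parentSets (splitLevel i B l) (j + 1)).card = (parentSets l j).card := by
  obtain ⟨j, rfl⟩ : ∃ k, j = k + 1 := ⟨j - 1, by omega⟩
  exact card_parentSets_congr (cumul_splitLevel_of_gt hB (by omega))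
    (cumul_splitLevel_of_gt hB (by omega))

/-- Only two kinds of vertices are affected: the `a` lifted vertices of level `i` gain, and those of
level `i + 1` lose a little. -/
theorem card_parentFunctions_splitLevel (hB : ∀ v ∈ B, l v = i) (hb : B.card = b)
    (ha : layer l i = b + a) :
    (2 ^ b - 1 : ℝ) ^ a * (1 - (1 / 2) ^ a) ^ layer l (i + 1) * (parentFunctions l).card ≤
      (parentFunctions (splitLevel i B l)).card := by
  rw [card_parentFunctions, card_parentFunctions]
  push_cast
  set A := (Finset.univ.filter fun v => l v = i) \ B with hA
  have hAc : A.card = a := by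
    rw [hA, Finset.card_sdiff_of_subset fun v hv => by simp [hB v hv], hb]
    have : (Finset.univ.filter fun v => l v = i).card = b + a := ha
    omega
  have h1 : ∏ v, (if v ∈ A then (2 ^ b - 1 : ℝ) else 1) = (2 ^ b - 1 : ℝ) ^ a := by
    rw [Finset.prod_ite_mem, Finset.univ_inter, Finset.prod_const, hAc]
  have h2 : ∏ v, (if l v = i + 1 then (1 - (1 / 2) ^ a : ℝ) else 1) =
      (1 - (1 / 2) ^ a : ℝ) ^ layer l (i + 1) := by
    rw [← Finset.prod_filter, Finset.prod_const]
    rfl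
  rw [← h1, ← h2, ← Finset.prod_mul_distrib, ← Finset.prod_mul_distrib]
  have h3 : (0 : ℝ) ≤ 2 ^ b - 1 := sub_nonneg.2 (one_le_pow₀ one_le_two)
  have h4 : (0 : ℝ) ≤ 1 - (1 / 2) ^ a :=
    sub_nonneg.2 (pow_le_one₀ (by norm_num) (by norm_num))
  refine Finset.prod_le_prod (fun v _ => ?_) fun v _ => ?_
  · split_ifs <;> positivity
  · have hBv := hB v
    by_cases hlt : l v < i ∨ v ∈ B
    · have hl : splitLevel i B l v = l v := if_pos hlt
      have hle : l v ≤ i := hlt.elim le_of_lt fun h => (hBv h).le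
      have hnA : v ∉ A := by
        simp only [hA, Finset.mem_sdiff, Finset.mem_filter, Finset.mem_univ, true_and, not_and,
          not_not]
        exact fun h => hlt.resolve_left (by omega)
      rw [hl, if_neg hnA, if_neg (by omega), card_parentSets_splitLevel_of_le hB hle]
      simp
    · have hl : splitLevel i B l v = l v + 1 := if_neg hlt
      push Not at hlt
      rcases eq_or_lt_of_le hlt.1 with he | he
      · have hvA : v ∈ A := by simp [hA, he, hlt.2]
        rw [hl, if_pos hvA, if_neg (by omega), mul_one, ← he]
        exact le_card_parentSets_splitLevel hB hb
      · have hnA : v ∉ A := by simp [hA]; omega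
        rcases eq_or_lt_of_le (Nat.succ_le_of_lt he) with he' | he'
        · rw [hl, if_neg hnA, if_pos he'.symm, one_mul, ← he']
          exact le_card_parentSets_splitLevel_succ hB hb ha
        · rw [hl, if_neg hnA, if_neg (by omega), one_mul, one_mul,
            card_parentSets_splitLevel_of_gt hB he']

end Split

theorem quarter_le_pow {a h : ℕ} (ha : 0 < a) (hh : h ≤ 2 ^ a) :
    (1 / 4 : ℝ) ≤ (1 - (1 / 2) ^ a) ^ h := by
  have h0 : (0 : ℝ) ≤ 1 - (1 / 2) ^ a :=
    sub_nonneg.2 (pow_le_one₀ (by norm_num) (by norm_num))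
  have h1 : (1 - (1 / 2) ^ a : ℝ) ^ (2 ^ a) ≤ (1 - (1 / 2) ^ a) ^ h :=
    pow_le_pow_of_le_one h0 (by linarith [show (0 : ℝ) ≤ (1 / 2) ^ a by positivity]) hh
  refine le_trans ?_ h1
  obtain ⟨k, rfl⟩ : ∃ k, a = k + 1 := ⟨a - 1, by omega⟩
  -- Bernoulli's inequality at the full exponent would only give 0, so it is used at half of it and
  -- the result is squared.
  have h2 : (1 / 2 : ℝ) ≤ (1 - (1 / 2) ^ (k + 1)) ^ (2 ^ k) := by
    have h3 : (-2 : ℝ) ≤ -(1 / 2) ^ (k + 1) := by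
      have : ((1 : ℝ) / 2) ^ (k + 1) ≤ 1 := pow_le_one₀ (by norm_num) (by norm_num)
      linarith
    have h4 := one_add_mul_le_pow h3 (2 ^ k)
    have h5 : (2 : ℝ) ^ k * (1 / 2) ^ (k + 1) = 1 / 2 := by
      rw [pow_succ, ← mul_assoc, ← mul_pow]
      norm_num
    push_cast at h4
    rw [← sub_eq_add_neg] at h4
    linarith
  rw [pow_succ 2 k, pow_mul]
  calc (1 / 4 : ℝ) = (1 / 2) ^ 2 := by norm_num
    _ ≤ _ := pow_le_pow_left₀ (by norm_num) h2 2

theorem pow_exponent_le {g : ℕ} (hg : 6 ≤ g) : g ^ 2 ≤ 8 * ((g / 2 - 1) * (g - g / 2)) := by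
  obtain ⟨k, rfl | rfl⟩ : ∃ k, g = 2 * k ∨ g = 2 * k + 1 := ⟨g / 2, by omega⟩
  · obtain ⟨j, rfl⟩ : ∃ j, k = j + 3 := ⟨k - 3, by omega⟩
    rw [show 2 * (j + 3) / 2 - 1 = j + 2 by omega,
      show 2 * (j + 3) - 2 * (j + 3) / 2 = j + 3 by omega]
    nlinarith
  · obtain ⟨j, rfl⟩ : ∃ j, k = j + 3 := ⟨k - 3, by omega⟩
    rw [show (2 * (j + 3) + 1) / 2 - 1 = j + 2 by omega,
      show 2 * (j + 3) + 1 - (2 * (j + 3) + 1) / 2 = j + 4 by omega]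
    nlinarith

open Classical in
-- Lifting half of the layer gains a factor at least `2 ^ E` with `8 * E ≥ g ^ 2`. The bound on the
-- next layer keeps the loss there to a factor 4 (`quarter_le_pow`).
theorem card_layer_eq_le (i : ℕ) {g : ℕ} (hg : 6 ≤ g) :
    ((Finset.univ.filter fun G : LabeledDAG n => layer G.height i = g ∧
      layer G.height (i + 1) ≤ 2 ^ (g - g / 2)).card : ℝ) ≤
      4 * (23 / 25) ^ g ^ 2 * Fintype.card (LabeledDAG n) := by
  have hB : ∀ l : Fin n → ℕ, ∃ B : Finset (Fin n), (∀ v ∈ B, l v = i) ∧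
      (layer l i = g → B.card = g / 2) := by
    intro l
    by_cases h : layer l i = g
    · obtain ⟨B, hB, hB'⟩ := Finset.exists_subset_card_eq
        (s := Finset.univ.filter fun v => l v = i) (n := g / 2)
        (by have : (Finset.univ.filter fun v => l v = i).card = g := h
            omega)
      exact ⟨B, fun v hv => by simpa using hB hv, fun _ => hB'⟩
    · exact ⟨∅, by simp, fun h' => absurd h' h⟩
  choose B hB hBc using hB
  refine le_trans (le_of_eq (by congr!)) <| card_height_le_of_injOn (fun l => layer l i = g ∧ layer l (i + 1) ≤ 2 ^ (g - g / 2))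
    (fun l => splitLevel i (B l) l) (4 * (23 / 25) ^ g ^ 2) (by positivity) ?_ ?_
  · intro l _ l' _ h
    funext v
    have h' := congrFun h v
    simp only at h'
    rw [eq_of_splitLevel (hB l) v, eq_of_splitLevel (hB l') v, h']
  · rintro l ⟨h1, h2⟩
    have h3 := card_parentFunctions_splitLevel (hB l) (hBc l h1) (a := g - g / 2) (by omega)
    have h4 := quarter_le_pow (a := g - g / 2) (by omega) h2
    set W : ℝ := ((parentFunctions l).card : ℝ)
    set W' : ℝ := ((parentFunctions (splitLevel i (B l) l)).card : ℝ)
    have h5 : (2 : ℝ) ^ (g / 2 - 1) ≤ 2 ^ (g / 2) - 1 := by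
      obtain ⟨k, hk⟩ : ∃ k, g / 2 = k + 1 := ⟨g / 2 - 1, by omega⟩
      rw [hk, pow_succ, Nat.add_sub_cancel]
      linarith [one_le_pow₀ (M₀ := ℝ) one_le_two (n := k)]
    have h5' : (0 : ℝ) ≤ 2 ^ (g / 2) - 1 := (by positivity : (0 : ℝ) ≤ 2 ^ (g / 2 - 1)).trans h5
    have h6 : ((2 : ℝ) ^ (g / 2 - 1)) ^ (g - g / 2) ≤ (2 ^ (g / 2) - 1) ^ (g - g / 2) :=
      pow_le_pow_left₀ (by positivity) h5 _
    rw [← pow_mul] at h6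
    set E := (g / 2 - 1) * (g - g / 2)
    have h7 : (1 : ℝ) ≤ (23 / 25) ^ g ^ 2 * 2 ^ E := by
      calc (1 : ℝ) ≤ ((23 / 25) ^ 8 * 2) ^ E := one_le_pow₀ (by norm_num)
        _ = (23 / 25) ^ (8 * E) * 2 ^ E := by rw [mul_pow, ← pow_mul]
        _ ≤ _ := mul_le_mul_of_nonneg_right
          (pow_le_pow_of_le_one (by norm_num) (by norm_num) (pow_exponent_le hg)) (by positivity)
    have hW : 0 ≤ W := Nat.cast_nonneg _
    have h8 : (2 : ℝ) ^ E * (1 / 4) * W ≤ W' := by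
      refine le_trans (mul_le_mul_of_nonneg_right ?_ hW) h3
      exact mul_le_mul h6 h4 (by norm_num) (pow_nonneg h5' _)
    calc W = 1 * W := (one_mul W).symm
      _ ≤ ((23 / 25) ^ g ^ 2 * 2 ^ E) * W := mul_le_mul_of_nonneg_right h7 hW
      _ = 4 * (23 / 25) ^ g ^ 2 * (2 ^ E * (1 / 4) * W) := by ring
      _ ≤ _ := mul_le_mul_of_nonneg_left h8 (by positivity)

open Classical in
/-- Gaussian tails for the sizes of the layers of a uniform DAG. -/
theorem card_le_layer_le (n g i : ℕ) :
    ((Finset.univ.filter fun G : LabeledDAG n => g ≤ layer G.height i).card : ℝ) ≤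
      2 ^ 18 * (24 / 25) ^ g ^ 2 * Fintype.card (LabeledDAG n) := by
  have hD : (0 : ℝ) ≤ Fintype.card (LabeledDAG n) := Nat.cast_nonneg _
  -- Descending induction on g. Either layer i has exactly g vertices and the next layer is small
  -- enough for the splitting bound, or one of the layers i and i + 1 has more than g vertices.
  suffices H : ∀ k g i, n < g + k →
      ((Finset.univ.filter fun G : LabeledDAG n => g ≤ layer G.height i).card : ℝ) ≤
        2 ^ 18 * (24 / 25) ^ g ^ 2 * Fintype.card (LabeledDAG n) from
    H (n + 1) g i (by omega)
  intro k
  induction k with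
  | zero =>
    intro g i hg
    rw [Finset.filter_false_of_mem, Finset.card_empty, Nat.cast_zero]
    · positivity
    · intro G _ h
      have : layer G.height i ≤ n := (Finset.card_le_univ _).trans (Fintype.card_fin n).le
      omega
  | succ k ih =>
    intro g i hg
    -- The constant 2 ^ 18 makes the bound trivial up to g = 16.
    by_cases hg17 : g < 17
    · refine le_trans (Nat.cast_le.2 (Finset.card_le_univ _)) (le_mul_of_one_le_left hD ?_)
      calc (1 : ℝ) ≤ 2 ^ 18 * (24 / 25) ^ 16 ^ 2 := by norm_num
        _ ≤ _ := mul_le_mul_of_nonneg_left (pow_le_pow_of_le_one (by norm_num) (by norm_num)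
          (Nat.pow_le_pow_left (by omega) 2)) (by norm_num)
    push Not at hg17
    have h1 := ih (g + 1) i (by omega)
    have h2 := ih (g + 1) (i + 1) (by omega)
    have h3 := card_layer_eq_le (n := n) i (g := g) (by omega)
    have h4 : g ≤ 2 ^ (g - g / 2) := by
      have : g / 2 < 2 ^ (g / 2) := Nat.lt_two_pow_self
      rcases Nat.even_or_odd' g with ⟨j, rfl | rfl⟩
      · obtain ⟨j, rfl⟩ : ∃ k, j = k + 1 := ⟨j - 1, by omega⟩
        have : j < 2 ^ j := Nat.lt_two_pow_self
        rw [show 2 * (j + 1) - 2 * (j + 1) / 2 = j + 1 by omega, pow_succ]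
        omega
      · have : j < 2 ^ j := Nat.lt_two_pow_self
        rw [show 2 * j + 1 - (2 * j + 1) / 2 = j + 1 by omega, pow_succ]
        omega
    set D : ℝ := (Fintype.card (LabeledDAG n) : ℝ)
    have h5 : ((Finset.univ.filter fun G : LabeledDAG n => g ≤ layer G.height i).card : ℝ) ≤
        (Finset.univ.filter fun G : LabeledDAG n => layer G.height i = g ∧
          layer G.height (i + 1) ≤ 2 ^ (g - g / 2)).card +
        ((Finset.univ.filter fun G : LabeledDAG n => g + 1 ≤ layer G.height i).card +
        (Finset.univ.filter fun G : LabeledDAG n => g + 1 ≤ layer G.height (i + 1)).card) := by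
      norm_cast
      refine le_trans (Finset.card_le_card ?_) ((Finset.card_union_le _ _).trans
        (Nat.add_le_add_left (Finset.card_union_le _ _) _))
      intro G hG
      simp only [Finset.mem_union, Finset.mem_filter, Finset.mem_univ, true_and] at hG ⊢
      omega
    refine h5.trans ((add_le_add h3 (add_le_add h1 h2)).trans ?_)
    -- For g ≥ 17, passing to g + 1 shrinks the bound by a factor 4, so the two inductive terms use
    -- up only half of it.
    have h6 : (24 / 25 : ℝ) ^ (g + 1) ^ 2 ≤ (24 / 25) ^ g ^ 2 * (1 / 4) := by
      rw [show (g + 1) ^ 2 = g ^ 2 + (2 * g + 1) by ring, pow_add]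
      refine mul_le_mul_of_nonneg_left ?_ (by positivity)
      calc (24 / 25 : ℝ) ^ (2 * g + 1) ≤ (24 / 25) ^ 35 :=
            pow_le_pow_of_le_one (by norm_num) (by norm_num) (by omega)
        _ ≤ _ := by norm_num
    have h7 : (23 / 25 : ℝ) ^ g ^ 2 ≤ (24 / 25) ^ g ^ 2 :=
      pow_le_pow_left₀ (by norm_num) (by norm_num) _
    nlinarith [mul_le_mul_of_nonneg_right h6 hD, mul_le_mul_of_nonneg_right h7 hD,
      mul_nonneg (by positivity : (0 : ℝ) ≤ (24 / 25) ^ g ^ 2) hD]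

end LabeledDAG

/-! ### Resampling one coordinate, and extracting disjoint pairs -/

theorem Finset.sum_piFinset_sum_update {ι α : Type*} [Fintype ι] [DecidableEq ι]
    (A : ι → Finset α) (v : ι) (Φ : (ι → α) → ℝ) :
    ∑ x ∈ Fintype.piFinset A, ∑ a ∈ A v, Φ (Function.update x v a) =
      (A v).card * ∑ x ∈ Fintype.piFinset A, Φ x := by
  have h : ∑ p ∈ Fintype.piFinset A ×ˢ A v, Φ (Function.update p.1 v p.2) =
      ∑ p ∈ Fintype.piFinset A ×ˢ A v, Φ p.1 := by
    -- Exchanging the coordinate at v with its independent copy is an involution.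
    refine Finset.sum_nbij' (fun p => (Function.update p.1 v p.2, p.1 v))
      (fun p => (Function.update p.1 v p.2, p.1 v)) ?_ ?_ ?_ ?_ ?_
    · rintro ⟨x, a⟩ hp
      simp only [Finset.mem_product, Fintype.mem_piFinset] at hp ⊢
      refine ⟨fun w => ?_, hp.1 v⟩
      by_cases hw : w = v
      · subst hw; simpa using hp.2
      · simpa [hw] using hp.1 w
    · rintro ⟨x, a⟩ hp
      simp only [Finset.mem_product, Fintype.mem_piFinset] at hp ⊢
      refine ⟨fun w => ?_, hp.1 v⟩
      by_cases hw : w = v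
      · subst hw; simpa using hp.2
      · simpa [hw] using hp.1 w
    · rintro ⟨x, a⟩ -
      simp
    · rintro ⟨x, a⟩ -
      simp
    · rintro ⟨x, a⟩ -
      rfl
  rw [Finset.sum_product, Finset.sum_product] at h
  rw [h]
  simp [Finset.mul_sum]

/-- Bounding a factor by its average over one coordinate in a sum over a product of finite sets. -/
theorem Finset.sum_piFinset_mul_le {ι α : Type*} [Fintype ι] [DecidableEq ι]
    (A : ι → Finset α) (v : ι) {F H c : (ι → α) → ℝ} (hF : ∀ x, 0 ≤ F x)
    (hFv : ∀ x a, F (Function.update x v a) = F x)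
    (hH : ∀ x ∈ Fintype.piFinset A,
      ∑ a ∈ A v, H (Function.update x v a) ≤ (A v).card * c x) :
    ∑ x ∈ Fintype.piFinset A, F x * H x ≤ ∑ x ∈ Fintype.piFinset A, F x * c x := by
  rcases (A v).eq_empty_or_nonempty with h0 | h0
  · have : Fintype.piFinset A = ∅ := by
      rw [Finset.eq_empty_iff_forall_notMem]
      intro x hx
      simpa [h0] using Fintype.mem_piFinset.1 hx v
    simp [this]
  · have hpos : (0 : ℝ) < (A v).card := by exact_mod_cast h0.card_pos
    refine le_of_mul_le_mul_left ?_ hpos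
    rw [← Finset.sum_piFinset_sum_update A v fun x => F x * H x, Finset.mul_sum]
    refine Finset.sum_le_sum fun x hx => ?_
    simp_rw [hFv, ← Finset.mul_sum]
    calc F x * ∑ a ∈ A v, H (Function.update x v a) ≤ F x * ((A v).card * c x) :=
          mul_le_mul_of_nonneg_left (hH x hx) (hF x)
      _ = _ := by ring

/-- From a map with small fibres one extracts many disjoint pairs `(f v, v)`. -/
theorem Finset.exists_disjoint_pairs {V : Type*} [DecidableEq V] (f : V → V) (k : ℕ) :
    ∀ (K : ℕ) (S : Finset V), (∀ u, (S.filter fun v => f v = u).card ≤ k) →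
      K * (2 * k + 1) ≤ S.card → ∃ J ⊆ S, J.card = K ∧
        ∀ v ∈ J, ∀ w ∈ J, v ≠ w → f v ≠ f w ∧ f v ≠ w := by
  intro K
  induction K with
  | zero => exact fun S _ _ => ⟨∅, by simp, by simp, by simp⟩
  | succ K ih =>
    intro S hS hK
    have hne : S.Nonempty := Finset.card_pos.1 (by rw [add_mul] at hK; omega)
    obtain ⟨v, hv⟩ := hne
    -- Greedy choice: R contains everything that conflicts with the pair (f v, v), at most 2k + 1
    -- elements.
    set R := (S.filter fun w => f w = f v) ∪ (S.filter fun w => f w = v) ∪ {f v} with hR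
    have hRc : R.card ≤ 2 * k + 1 := by
      have h1 := hS (f v)
      have h2 := hS v
      have h3 := Finset.card_union_le ((S.filter fun w => f w = f v) ∪ S.filter fun w => f w = v)
        {f v}
      have h4 := Finset.card_union_le (S.filter fun w => f w = f v) (S.filter fun w => f w = v)
      rw [Finset.card_singleton, ← hR] at h3
      omega
    obtain ⟨J, hJ, hJc, hJd⟩ := ih (S \ R)
      (fun u => (Finset.card_le_card (Finset.filter_subset_filter _
        Finset.sdiff_subset)).trans (hS u))
      (by have := Finset.le_card_sdiff R S; rw [add_mul] at hK; omega)
    have hJR : ∀ w ∈ J, f w ≠ f v ∧ f w ≠ v ∧ w ≠ f v := by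
      intro w hw
      have := Finset.mem_sdiff.1 (hJ hw)
      simp only [hR, Finset.mem_union, Finset.mem_filter, Finset.mem_singleton] at this
      tauto
    have hvJ : v ∉ J := fun h => (hJR v h).1 rfl
    refine ⟨insert v J, Finset.insert_subset hv (hJ.trans Finset.sdiff_subset),
      by rw [Finset.card_insert_of_notMem hvJ, hJc], ?_⟩
    intro a ha b hb hab
    rcases Finset.mem_insert.1 ha with ha' | ha' <;>
      rcases Finset.mem_insert.1 hb with hb' | hb'
    · exact absurd (ha'.trans hb'.symm) hab
    · exact ha' ▸ ⟨(hJR b hb').1.symm, (hJR b hb').2.2.symm⟩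
    · exact hb' ▸ ⟨(hJR a ha').1, (hJR a ha').2.1⟩
    · exact hJd a ha' b hb' hab

/-! ### Probability of domination for a fixed height function -/

namespace LabeledDAG

variable {n : ℕ} {l : Fin n → ℕ}

/-- The number of vertices in the layers below that of `v`. -/
def rank (l : Fin n → ℕ) (v : Fin n) : ℕ := cumul l (l v)

/-- Every level below an occupied one is occupied. -/
def Full (l : Fin n → ℕ) : Prop := ∀ v, ∀ j < l v, 0 < layer l j

theorem Full.two_pow_rank_le (hl : Full l) (v : Fin n) :
    (2 : ℝ) ^ rank l v ≤ 2 * (parentSets l (l v)).card := by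
  exact_mod_cast le_two_mul_card_parentSets (hl v)

theorem rank_mono {u v : Fin n} (h : l u ≤ l v) : rank l u ≤ rank l v := cumul_mono l h

theorem rank_add_layer_le {u v : Fin n} (h : l u < l v) :
    rank l u + layer l (l u) ≤ rank l v := by
  have := cumul_mono l (Nat.succ_le_of_lt h)
  rwa [Nat.succ_eq_add_one, cumul_succ] at this

theorem card_filter_subset_le (hl : Full l) (v : Fin n) (Q : Finset (Fin n)) :
    (((parentSets l (l v)).filter fun a => a ⊆ Q).card : ℝ) ≤
      (parentSets l (l v)).card * (2 * 2 ^ Q.card / 2 ^ rank l v) := by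
  have h1 : (((parentSets l (l v)).filter fun a => a ⊆ Q).card : ℝ) ≤ 2 ^ Q.card := by
    rw [← Nat.cast_ofNat, ← Nat.cast_pow, ← Finset.card_powerset]
    exact Nat.cast_le.2 (Finset.card_le_card fun a ha =>
      Finset.mem_powerset.2 (Finset.mem_filter.1 ha).2)
  refine h1.trans ?_
  rw [← mul_div_assoc, le_div_iff₀ (by positivity)]
  nlinarith [hl.two_pow_rank_le v, pow_pos (two_pos : (0 : ℝ) < 2) Q.card]

/-- All parents of `v` other than `u` are parents of `u`. -/
def Dominates (x : Fin n → Finset (Fin n)) (u v : Fin n) : Prop := x v ⊆ insert u (x u)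

instance (x : Fin n → Finset (Fin n)) (u v : Fin n) : Decidable (Dominates x u v) :=
  inferInstanceAs (Decidable (x v ⊆ insert u (x u)))

/-- Averaging first over the parents of `v` gives at most `4 * 2 ^ |x u| / 2 ^ rank v`. Averaging `2
^ |x u|` over the parents of `u` then gives at most `2 * (3 / 2) ^ rank u`, and `rank u ≤ rank v`.
The factor `F` stands for events not involving these two coordinates. -/
theorem sum_mul_dominates_le (hl : Full l) {u v : Fin n} (huv : l u < l v)
    {F : (Fin n → Finset (Fin n)) → ℝ} (hF : ∀ x, 0 ≤ F x)
    (hFu : ∀ x a, F (Function.update x u a) = F x)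
    (hFv : ∀ x a, F (Function.update x v a) = F x) :
    ∑ x ∈ parentFunctions l, F x * (if Dominates x u v then 1 else 0) ≤
      8 * (3 / 4) ^ rank l v * ∑ x ∈ parentFunctions l, F x := by
  have hne : u ≠ v := fun e => by rw [e] at huv; exact lt_irrefl _ huv
  have h1 : ∑ x ∈ parentFunctions l, F x * (if Dominates x u v then 1 else 0) ≤
      ∑ x ∈ parentFunctions l, F x * (4 / 2 ^ rank l v * 2 ^ (x u).card) := by
    refine Finset.sum_piFinset_mul_le _ v hF hFv fun x hx => ?_
    have h2 := card_filter_subset_le hl v (insert u (x u))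
    have h3 : (2 : ℝ) ^ (insert u (x u)).card ≤ 2 * 2 ^ (x u).card := by
      rw [← pow_succ']
      exact pow_le_pow_right₀ one_le_two (Finset.card_insert_le _ _)
    simp only [Dominates, Function.update_self, Function.update_of_ne hne]
    rw [← Finset.sum_filter, Finset.sum_const, nsmul_eq_mul, mul_one]
    refine h2.trans (mul_le_mul_of_nonneg_left ?_ (Nat.cast_nonneg _))
    rw [div_mul_eq_mul_div]
    exact div_le_div_of_nonneg_right (by linarith) (by positivity)
  refine h1.trans ?_
  have h4 : ∑ x ∈ parentFunctions l, F x * (4 / 2 ^ rank l v * 2 ^ (x u).card) ≤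
      ∑ x ∈ parentFunctions l, F x * (8 * (3 / 4) ^ rank l v) := by
    refine Finset.sum_piFinset_mul_le _ u hF hFu fun x _ => ?_
    simp only [Function.update_self]
    rw [← Finset.mul_sum]
    have h5 : ∑ a ∈ parentSets l (l u), (2 : ℝ) ^ a.card ≤ 3 ^ rank l u := by
      calc ∑ a ∈ parentSets l (l u), (2 : ℝ) ^ a.card
          ≤ ∑ a ∈ (Finset.univ.filter fun w => l w < l u).powerset, (2 : ℝ) ^ a.card :=
            Finset.sum_le_sum_of_subset_of_nonneg (Finset.filter_subset _ _)
              fun _ _ _ => by positivity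
        _ = 3 ^ rank l u := by
            have := Finset.sum_pow_mul_eq_add_pow (2 : ℝ) 1
              (Finset.univ.filter fun w => l w < l u)
            simp only [one_pow, mul_one] at this
            rw [this, rank, cumul]
            norm_num
    have h6 := hl.two_pow_rank_le u
    have h7 : (3 : ℝ) ^ rank l u ≤ (3 / 2) ^ rank l v * 2 ^ rank l u := by
      calc (3 : ℝ) ^ rank l u = (3 / 2) ^ rank l u * 2 ^ rank l u := by
            rw [← mul_pow]; norm_num
        _ ≤ _ := mul_le_mul_of_nonneg_right
          (pow_le_pow_right₀ (by norm_num) (rank_mono huv.le)) (by positivity)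
    have h8 : (3 / 4 : ℝ) ^ rank l v = (3 / 2) ^ rank l v / 2 ^ rank l v := by
      rw [← div_pow]; norm_num
    rw [h8, div_mul_eq_mul_div, ← mul_div_assoc, ← mul_div_assoc]
    refine div_le_div_of_nonneg_right ?_ (by positivity)
    nlinarith [mul_le_mul_of_nonneg_left h6 (by positivity : (0 : ℝ) ≤ (3 / 2) ^ rank l v)]
  refine h4.trans (le_of_eq ?_)
  rw [← Finset.sum_mul, mul_comm]

theorem dominates_update {x : Fin n → Finset (Fin n)} {u v w : Fin n} (hu : w ≠ u) (hv : w ≠ v)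
    (a : Finset (Fin n)) : Dominates (Function.update x w a) u v ↔ Dominates x u v := by
  simp [Dominates, Function.update_of_ne hu.symm, Function.update_of_ne hv.symm]

/-- The pairs are disjoint, so the events depend on disjoint sets of coordinates and can be peeled
off one at a time. -/
theorem card_forall_dominates_le (hl : Full l) (f : Fin n → Fin n) (J : Finset (Fin n))
    (hf : ∀ v ∈ J, l (f v) < l v)
    (hJ : ∀ v ∈ J, ∀ w ∈ J, v ≠ w → f v ≠ f w ∧ f v ≠ w) :
    (((parentFunctions l).filter fun x => ∀ v ∈ J, Dominates x (f v) v).card : ℝ) ≤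
      (∏ v ∈ J, 8 * (3 / 4) ^ rank l v) * (parentFunctions l).card := by
  have h0 : ∀ J : Finset (Fin n),
      (((parentFunctions l).filter fun x => ∀ v ∈ J, Dominates x (f v) v).card : ℝ) =
        ∑ x ∈ parentFunctions l, ∏ v ∈ J, if Dominates x (f v) v then 1 else 0 := by
    intro J
    rw [Finset.card_filter]
    push_cast
    refine Finset.sum_congr rfl fun x _ => ?_
    rw [Finset.prod_ite_zero]
    simp
  induction J using Finset.induction_on with
  | empty => simp
  | insert v J hv ih =>
    have ih' := ih (fun w hw => hf w (Finset.mem_insert_of_mem hw)) fun a ha b hb =>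
      hJ a (Finset.mem_insert_of_mem ha) b (Finset.mem_insert_of_mem hb)
    rw [h0] at ih' ⊢
    simp_rw [Finset.prod_insert hv]
    have hw : ∀ w ∈ J, v ≠ w ∧ v ≠ f w ∧ f v ≠ w ∧ f v ≠ f w := by
      intro w hw
      have hne : v ≠ w := fun e => hv (e ▸ hw)
      have h1 := hJ v (Finset.mem_insert_self _ _) w (Finset.mem_insert_of_mem hw) hne
      have h2 := hJ w (Finset.mem_insert_of_mem hw) v (Finset.mem_insert_self _ _) hne.symm
      exact ⟨hne, h2.2.symm, h1.2, h1.1⟩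
    have key := sum_mul_dominates_le hl (hf v (Finset.mem_insert_self _ _))
      (F := fun x => ∏ w ∈ J, if Dominates x (f w) w then 1 else 0)
      (fun x => Finset.prod_nonneg fun w _ => by split_ifs <;> norm_num)
      (fun x a => Finset.prod_congr rfl fun w hwJ => by
        rw [if_congr (dominates_update (hw w hwJ).2.2.2 (hw w hwJ).2.2.1 a) rfl rfl])
      (fun x a => Finset.prod_congr rfl fun w hwJ => by
        rw [if_congr (dominates_update (hw w hwJ).2.1 (hw w hwJ).1 a) rfl rfl])
    calc _ = ∑ x ∈ parentFunctions l, (∏ w ∈ J, if Dominates x (f w) w then (1 : ℝ) else 0) *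
            (if Dominates x (f v) v then 1 else 0) :=
          Finset.sum_congr rfl fun x _ => mul_comm _ _
      _ ≤ _ := key
      _ ≤ 8 * (3 / 4) ^ rank l v * ((∏ w ∈ J, 8 * (3 / 4) ^ rank l w) *
            (parentFunctions l).card) := mul_le_mul_of_nonneg_left ih' (by positivity)
      _ = _ := by ring

theorem card_forall_subset_le (hl : Full l) (Q V : Finset (Fin n)) :
    (((parentFunctions l).filter fun x => ∀ v ∈ V, x v ⊆ Q).card : ℝ) ≤
      (∏ v ∈ V, 2 * 2 ^ Q.card / 2 ^ rank l v) * (parentFunctions l).card := by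
  have h0 : (parentFunctions l).filter (fun x => ∀ v ∈ V, x v ⊆ Q) = Fintype.piFinset fun v =>
      if v ∈ V then (parentSets l (l v)).filter fun a => a ⊆ Q else parentSets l (l v) := by
    ext x
    simp only [parentFunctions, Finset.mem_filter, Fintype.mem_piFinset]
    constructor
    · rintro ⟨h1, h2⟩ v
      split_ifs with hv
      · exact Finset.mem_filter.2 ⟨h1 v, h2 v hv⟩
      · exact h1 v
    · intro h
      refine ⟨fun v => ?_, fun v hv => ?_⟩
      · have := h v
        split_ifs at this
        exacts [(Finset.mem_filter.1 this).1, this]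
      · have := h v
        rw [if_pos hv] at this
        exact (Finset.mem_filter.1 this).2
  rw [h0, Fintype.card_piFinset, card_parentFunctions]
  push_cast
  have h1 : ∏ v ∈ V, (2 * 2 ^ Q.card / 2 ^ rank l v : ℝ) =
      ∏ v, if v ∈ V then (2 * 2 ^ Q.card / 2 ^ rank l v : ℝ) else 1 := by
    rw [Finset.prod_ite_mem, Finset.univ_inter]
  rw [h1, ← Finset.prod_mul_distrib]
  refine Finset.prod_le_prod (fun _ _ => Nat.cast_nonneg _) fun v _ => ?_
  split_ifs
  · rw [mul_comm]
    exact card_filter_subset_le hl v Q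
  · rw [one_mul]

/-- `T` lies between level `i` and its own top level, which has at most `r` vertices below it, while
that level itself has at most `t`. -/
theorem card_le_of_rank_le {T : Finset (Fin n)} {i r t : ℕ} (hi : ∀ v ∈ T, i ≤ l v)
    (hr : ∀ v ∈ T, rank l v ≤ r) (ht : ∀ v ∈ T, layer l (l v) ≤ t) :
    T.card ≤ r + t - cumul l i := by
  rcases T.eq_empty_or_nonempty with rfl | hT
  · simp
  obtain ⟨v, hv, hmax⟩ := Finset.exists_max_image T l hT
  have h1 : T ⊆ (Finset.univ.filter fun u => l u < l v + 1) \
      Finset.univ.filter fun u => l u < i := by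
    intro w hw
    have h2 := hmax w hw
    have h3 := hi w hw
    simp only [Finset.mem_sdiff, Finset.mem_filter, Finset.mem_univ, true_and]
    omega
  refine (Finset.card_le_card h1).trans ?_
  rw [Finset.card_sdiff_of_subset]
  · have h2 : cumul l (l v + 1) = rank l v + layer l (l v) := cumul_succ l _
    have h3 := hr v hv
    have h4 := ht v hv
    change cumul l (l v + 1) - cumul l i ≤ _
    omega
  · intro w hw
    have h3 := hi v hv
    simp only [Finset.mem_filter, Finset.mem_univ, true_and] at hw ⊢
    omega

end LabeledDAG

/-! ### Union bounds and elementary estimates -/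

theorem Finset.card_filter_exists_le {α ι : Type*} [DecidableEq α] (Ω : Finset α) (I : Finset ι)
    (P : ι → α → Prop) [∀ i, DecidablePred (P i)] [DecidablePred fun x => ∃ i ∈ I, P i x]
    (c : ι → ℝ) (h : ∀ i ∈ I, ((Ω.filter (P i)).card : ℝ) ≤ c i) :
    ((Ω.filter fun x => ∃ i ∈ I, P i x).card : ℝ) ≤ ∑ i ∈ I, c i := by
  have h1 : (Ω.filter fun x => ∃ i ∈ I, P i x) ⊆ I.biUnion fun i => Ω.filter (P i) := by
    intro x hx
    obtain ⟨hx, i, hi, hP⟩ := Finset.mem_filter.1 hx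
    exact Finset.mem_biUnion.2 ⟨i, hi, Finset.mem_filter.2 ⟨hx, hP⟩⟩
  calc ((Ω.filter fun x => ∃ i ∈ I, P i x).card : ℝ)
      ≤ ((∑ i ∈ I, (Ω.filter (P i)).card : ℕ) : ℝ) :=
        Nat.cast_le.2 ((Finset.card_le_card h1).trans Finset.card_biUnion_le)
    _ ≤ _ := by push_cast; exact Finset.sum_le_sum h

theorem Finset.card_filter_le_of_imp_or {α : Type*} [DecidableEq α] {Ω : Finset α}
    {P P₁ P₂ P₃ : α → Prop} [DecidablePred P] [DecidablePred P₁] [DecidablePred P₂]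
    [DecidablePred P₃] {a b c : ℝ} (h₁ : ((Ω.filter P₁).card : ℝ) ≤ a)
    (h₂ : ((Ω.filter P₂).card : ℝ) ≤ b) (h₃ : ((Ω.filter P₃).card : ℝ) ≤ c)
    (h : ∀ x ∈ Ω, P x → P₁ x ∨ P₂ x ∨ P₃ x) : ((Ω.filter P).card : ℝ) ≤ a + (b + c) := by
  refine le_trans ?_ (add_le_add h₁ (add_le_add h₂ h₃))
  have h' : Ω.filter P ⊆ Ω.filter P₁ ∪ (Ω.filter P₂ ∪ Ω.filter P₃) := by
    intro x hx
    simp only [Finset.mem_union, Finset.mem_filter] at hx ⊢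
    have := h x hx.1 hx.2
    tauto
  exact_mod_cast (Finset.card_le_card h').trans ((Finset.card_union_le _ _).trans
    (Nat.add_le_add_left (Finset.card_union_le _ _) _))

theorem exists_forall_sq_mul_pow_le :
    ∃ K : ℝ, 0 < K ∧ ∀ r : ℕ, (r : ℝ) ^ 2 * (3 / 4) ^ r ≤ K * (4 / 5) ^ r := by
  -- The ratio is chosen so that 15/16 · 4/5 = 3/4.
  have h := (tendsto_pow_const_mul_const_pow_of_abs_lt_one 2
    (r := (15 / 16 : ℝ)) (by rw [abs_lt]; norm_num)).bddAbove_range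
  obtain ⟨K, hK⟩ := h
  refine ⟨max K 1, by positivity, fun r => ?_⟩
  have h1 : (r : ℝ) ^ 2 * (15 / 16) ^ r ≤ max K 1 := (hK ⟨r, rfl⟩).trans (le_max_left _ _)
  calc (r : ℝ) ^ 2 * (3 / 4) ^ r = (r ^ 2 * (15 / 16) ^ r) * (4 / 5) ^ r := by
        rw [mul_assoc, ← mul_pow]; norm_num
    _ ≤ _ := mul_le_mul_of_nonneg_right h1 (by positivity)

theorem exists_forall_const_mul_pow_le (c r : ℝ) (h0 : 0 ≤ r) (h1 : r < 1) :
    ∃ q₀ : ℕ, ∀ q ≥ q₀, c * (q : ℝ) ^ 12 * r ^ q ≤ 1 := by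
  have h := (tendsto_pow_const_mul_const_pow_of_abs_lt_one 12
    (r := r) (by rwa [abs_of_nonneg h0])).const_mul c
  rw [mul_zero] at h
  obtain ⟨q₀, hq⟩ := Filter.eventually_atTop.1 (h.eventually (ge_mem_nhds zero_lt_one))
  exact ⟨q₀, fun q hq' => by rw [mul_assoc]; exact hq q hq'⟩

/-! ### Many dominated vertices are unlikely for tame height functions -/

namespace LabeledDAG

variable {n : ℕ} {l : Fin n → ℕ}

/-- The layer sizes are at most of the order of `√N` up to rank `N`. -/
def Tame (N : ℕ) (l : Fin n → ℕ) : Prop := ∀ v, layer l (l v) ^ 2 ≤ N + rank l v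

/-- The dominated vertices in terms of the parent function. -/
def dominatedSet (x : Fin n → Finset (Fin n)) : Finset (Fin n) :=
  Finset.univ.filter fun v => ∃ u ∈ x v, Dominates x u v

theorem card_dominatedSet (G : LabeledDAG n) :
    (dominatedSet G.parents).card = G.dominatedVertices.ncard := by
  rw [← Set.ncard_coe_finset]
  congr 1
  ext v
  have h : v ∈ dominatedSet G.parents ↔ ∃ u ∈ G.parents v, Dominates G.parents u v := by
    simp [dominatedSet]
  rw [Finset.mem_coe, h]
  simp only [Dominates, mem_parents, Finset.subset_iff, Finset.mem_insert]
  exact exists_congr fun u => and_congr_right fun _ => forall_congr' fun w => by tauto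

/-- The vertices of rank less than `N`. -/
def lowVertices (N : ℕ) (l : Fin n → ℕ) : Finset (Fin n) :=
  Finset.univ.filter fun v => rank l v < N

theorem mem_lowVertices {N : ℕ} {v : Fin n} : v ∈ lowVertices N l ↔ rank l v < N := by
  simp [lowVertices]

section

variable {q : ℕ}

theorem Tame.layer_le (hl : Tame (q ^ 6) l) {v : Fin n} (hv : rank l v < q ^ 6) :
    layer l (l v) ≤ 2 * q ^ 3 := by
  by_contra! h
  have h1 := hl v
  have h2 := Nat.pow_lt_pow_left h two_ne_zero
  have h3 : (2 * q ^ 3) ^ 2 = 4 * q ^ 6 := by ring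
  omega

theorem Tame.card_lowVertices_le (hl : Tame (q ^ 6) l) (hq : 0 < q) :
    (lowVertices (q ^ 6) l).card ≤ 3 * q ^ 6 := by
  have h := card_le_of_rank_le (l := l) (T := lowVertices (q ^ 6) l) (i := 0) (r := q ^ 6)
    (t := 2 * q ^ 3) (fun _ _ => Nat.zero_le _) (fun v hv => (mem_lowVertices.1 hv).le)
    (fun v hv => hl.layer_le (mem_lowVertices.1 hv))
  have h2 : q ^ 3 ≤ q ^ 6 := Nat.pow_le_pow_right hq (by norm_num)
  omega

/-- Many dominated vertices force one of three unlikely configurations: one of high rank,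
many far above a common dominating vertex, or many disjoint dominating pairs. -/
theorem Tame.exists_of_le_card_dominatedSet (hl : Tame (q ^ 6) l) (hq : 20 ≤ q)
    {x : Fin n → Finset (Fin n)} (hx : ∀ v, ∀ u ∈ x v, l u < l v)
    (hS : q ^ 5 ≤ (dominatedSet x).card) :
    (∃ v, q ^ 6 ≤ rank l v ∧ ∃ u, l u < l v ∧ Dominates x u v) ∨
    (∃ u ∈ lowVertices (q ^ 6) l, ∃ V ∈ (lowVertices (q ^ 6) l).powersetCard (2 * q ^ 3),
      (∀ v ∈ V, rank l u + 2 * q ^ 3 < rank l v) ∧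
        ∀ v ∈ V, x v ⊆ insert u (Finset.univ.filter fun w => l w < l u)) ∨
    ∃ J ∈ (lowVertices (q ^ 6) l).powersetCard q,
      ∃ f ∈ Fintype.piFinset fun v => if v ∈ J then lowVertices (q ^ 6) l else {v},
        ((∀ v ∈ J, q ^ 5 ≤ 4 * rank l v) ∧ (∀ v ∈ J, l (f v) < l v) ∧
          ∀ v ∈ J, ∀ w ∈ J, v ≠ w → f v ≠ f w ∧ f v ≠ w) ∧
        ∀ v ∈ J, Dominates x (f v) v := by
  classical
  rw [or_iff_not_imp_left]
  intro hF
  push Not at hF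
  have hex : ∀ v ∈ dominatedSet x, ∃ u ∈ x v, Dominates x u v := fun v hv =>
    (Finset.mem_filter.1 hv).2
  have hlow : ∀ v ∈ dominatedSet x, rank l v < q ^ 6 := by
    intro v hv
    obtain ⟨u, hu, hd⟩ := hex v hv
    by_contra! h
    exact hF v h u (hx v u hu) hd
  choose! f hfx hf using hex
  have hfl : ∀ v ∈ dominatedSet x, l (f v) < l v := fun v hv => hx v _ (hfx v hv)
  have hflow : ∀ v ∈ dominatedSet x, rank l (f v) < q ^ 6 := fun v hv =>
    (rank_mono (hfl v hv).le).trans_lt (hlow v hv)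
  set S := (dominatedSet x).filter fun v => q ^ 5 ≤ 4 * rank l v with hSdef
  have hSd : ∀ v ∈ S, v ∈ dominatedSet x := fun v hv => (Finset.mem_filter.1 hv).1
  -- At most q^5/4 + 2q^3 dominated vertices have rank below q^5/4; for q ≥ 20 the others suffice
  -- for `Finset.exists_disjoint_pairs` with fibres of size 6q^3.
  have hScard : q * (2 * (6 * q ^ 3) + 1) ≤ S.card := by
    have h1 := card_le_of_rank_le (l := l)
      (T := (dominatedSet x).filter fun v => ¬ q ^ 5 ≤ 4 * rank l v)
      (i := 0) (r := q ^ 5 / 4) (t := 2 * q ^ 3) (fun _ _ => Nat.zero_le _)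
      (fun v hv => by have := (Finset.mem_filter.1 hv).2; omega)
      (fun v hv => hl.layer_le (hlow v (Finset.mem_filter.1 hv).1))
    have h2 := Finset.card_filter_add_card_filter_not (s := dominatedSet x)
      (fun v => q ^ 5 ≤ 4 * rank l v)
    have h3 : 20 * q ^ 4 ≤ q ^ 5 := by
      rw [pow_succ q 4, mul_comm]; exact Nat.mul_le_mul_left _ hq
    have h4 : 20 * q ^ 3 ≤ q ^ 4 := by
      rw [pow_succ q 3, mul_comm]; exact Nat.mul_le_mul_left _ hq
    have h5 : q ≤ q ^ 3 := Nat.le_self_pow (by norm_num) q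
    have h6 : q * (2 * (6 * q ^ 3) + 1) = 12 * q ^ 4 + q := by ring
    have h7 : 8000 ≤ q ^ 3 := Nat.pow_le_pow_left hq 3
    rw [← hSdef] at h2
    omega
  by_cases hfib : ∀ u, (S.filter fun v => f v = u).card ≤ 6 * q ^ 3
  · right
    obtain ⟨J, hJS, hJc, hJ⟩ := Finset.exists_disjoint_pairs f _ q S hfib hScard
    have hJd := fun v hv => hSd v (hJS hv)
    -- Making the function the identity off J leaves only |L|^q functions for the union bound, L
    -- being the set of low vertices.
    refine ⟨J, Finset.mem_powersetCard.2 ⟨fun v hv => mem_lowVertices.2 (hlow v (hJd v hv)), hJc⟩,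
      fun v => if v ∈ J then f v else v, ?_, ⟨?_, ?_, ?_⟩, ?_⟩
    · refine Fintype.mem_piFinset.2 fun v => ?_
      split_ifs with h
      · exact mem_lowVertices.2 (hflow v (hJd v h))
      · exact Finset.mem_singleton_self v
    · exact fun v hv => (Finset.mem_filter.1 (hJS hv)).2
    · intro v hv
      simp only [if_pos hv]
      exact hfl v (hJd v hv)
    · intro v hv w hw hne
      simp only [if_pos hv, if_pos hw]
      exact hJ v hv w hw hne
    · intro v hv
      simp only [if_pos hv]
      exact hf v (hJd v hv)
  · left
    push Not at hfib
    obtain ⟨u, hu⟩ := hfib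
    set T := S.filter fun v => f v = u
    have hT : ∀ v ∈ T, v ∈ dominatedSet x ∧ f v = u := fun v hv =>
      ⟨hSd v (Finset.mem_filter.1 hv).1, (Finset.mem_filter.1 hv).2⟩
    -- Of the more than 6q^3 vertices dominated by u, at most 4q^3 have rank within 2q^3 of that of
    -- u, so more than 2q^3 remain far above u.
    have h1 := card_le_of_rank_le (l := l)
      (T := T.filter fun v => ¬ rank l u + 2 * q ^ 3 < rank l v)
      (i := l u) (r := rank l u + 2 * q ^ 3) (t := 2 * q ^ 3)
      (fun v hv => by
        obtain ⟨h1, h2⟩ := hT v (Finset.mem_filter.1 hv).1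
        exact h2 ▸ (hfl v h1).le)
      (fun v hv => not_lt.1 (Finset.mem_filter.1 hv).2)
      (fun v hv => hl.layer_le (hlow v (hT v (Finset.mem_filter.1 hv).1).1))
    have h2 := Finset.card_filter_add_card_filter_not (s := T)
      (fun v => rank l u + 2 * q ^ 3 < rank l v)
    have h3 : rank l u = cumul l (l u) := rfl
    obtain ⟨V, hV, hVc⟩ := Finset.exists_subset_card_eq
      (s := T.filter fun v => rank l u + 2 * q ^ 3 < rank l v) (n := 2 * q ^ 3) (by omega)
    have hV' : ∀ v ∈ V, v ∈ dominatedSet x ∧ f v = u := fun v hv =>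
      hT v (Finset.mem_filter.1 (hV hv)).1
    obtain ⟨v₀, hv₀⟩ : T.Nonempty := Finset.card_pos.1 (by omega)
    refine ⟨u, ?_, V, Finset.mem_powersetCard.2 ⟨fun v hv =>
      mem_lowVertices.2 (hlow v (hV' v hv).1), hVc⟩,
      fun v hv => (Finset.mem_filter.1 (hV hv)).2, fun v hv => ?_⟩
    · have := hT v₀ hv₀
      exact mem_lowVertices.2 (this.2 ▸ hflow v₀ this.1)
    · obtain ⟨h4, h5⟩ := hV' v hv
      have h6 := hf v h4
      rw [h5] at h6
      exact h6.trans (Finset.insert_subset_insert _ fun w hw => by simpa using hx u w hw)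

end

/-- Vertices of equal rank share a layer, because rank increases strictly from one occupied level to
a higher one. For rank `r ≥ N` tameness bounds that layer by `N + r ≤ 2 * r`. -/
theorem Tame.sum_rank_le {N : ℕ} (hl : Tame N l) {φ : ℕ → ℝ} (hφ : ∀ r, 0 ≤ φ r) :
    ∑ v ∈ Finset.univ.filter (fun v => N ≤ rank l v), φ (rank l v) ≤
      ∑ r ∈ Finset.Ico N (n + 1), 2 * r * φ r := by
  rw [← Finset.sum_fiberwise_of_maps_to (t := Finset.Ico N (n + 1)) (g := rank l)]
  · refine Finset.sum_le_sum fun r hr => ?_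
    rw [Finset.sum_congr rfl (g := fun _ => φ r) fun v hv => by rw [(Finset.mem_filter.1 hv).2],
      Finset.sum_const, nsmul_eq_mul]
    refine mul_le_mul_of_nonneg_right ?_ (hφ r)
    set T := ({v ∈ {v | N ≤ rank l v} | rank l v = r} : Finset (Fin n)) with hT
    rcases T.eq_empty_or_nonempty with h | ⟨v, hv⟩
    · rw [h]; simp
    · have hT' : ∀ w ∈ T, rank l w = r := fun w hw => (Finset.mem_filter.1 hw).2
      have h1 : T ⊆ Finset.univ.filter fun w => l w = l v := by
        intro w hw
        simp only [Finset.mem_filter, Finset.mem_univ, true_and]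
        have h2 := hT' w hw
        have h3 := hT' v hv
        have h4 := layer_pos l v
        have h5 := layer_pos l w
        rcases lt_trichotomy (l w) (l v) with h | h | h
        · have := rank_add_layer_le h; omega
        · exact h
        · have := rank_add_layer_le h; omega
      have h2 : T.card ≤ layer l (l v) := Finset.card_le_card h1
      have h3 := hl v
      rw [hT' v hv] at h3
      have h4 : N ≤ r := (Finset.mem_Ico.1 hr).1
      have h5 : layer l (l v) ≤ layer l (l v) ^ 2 := Nat.le_self_pow two_ne_zero _
      exact_mod_cast (by omega : T.card ≤ 2 * r)
  · intro v hv
    refine Finset.mem_coe.2 (Finset.mem_Ico.2 ⟨(Finset.mem_filter.1 hv).2, Nat.lt_succ_of_le ?_⟩)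
    change cumul l (l v) ≤ n
    exact (Finset.card_le_univ _).trans (Fintype.card_fin n).le

open Classical in
-- Union bound over pairs: at rank `r` there are at most `2 * r` choices of `v` and `r` of `u`, each
-- of probability at most `8 * (3 / 4) ^ r`.
theorem Tame.card_exists_high_le {K : ℝ}
    (hK : ∀ r : ℕ, (r : ℝ) ^ 2 * (3 / 4) ^ r ≤ K * (4 / 5) ^ r)
    {N : ℕ} (hl : Tame N l) (hf : Full l) :
    (((parentFunctions l).filter fun x =>
      ∃ v, N ≤ rank l v ∧ ∃ u, l u < l v ∧ Dominates x u v).card : ℝ) ≤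
      80 * K * (4 / 5) ^ N * (parentFunctions l).card := by
  set W : ℝ := ((parentFunctions l).card : ℝ)
  have hW : 0 ≤ W := Nat.cast_nonneg _
  have h1 : ∀ v, (((parentFunctions l).filter fun x =>
      ∃ u ∈ Finset.univ.filter (fun u => l u < l v), Dominates x u v).card : ℝ) ≤
      rank l v * (8 * (3 / 4) ^ rank l v) * W := by
    intro v
    refine (Finset.card_filter_exists_le _ _ _ (fun _ => 8 * (3 / 4) ^ rank l v * W)
      fun u hu => ?_).trans (le_of_eq ?_)
    · have := card_forall_dominates_le hf (fun _ => u) {v} (by simpa using hu) (by simp)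
      simpa using this
    · rw [Finset.sum_const, nsmul_eq_mul]
      change (rank l v : ℝ) * _ = _
      ring
  have h2 := Finset.card_filter_exists_le (parentFunctions l)
    (Finset.univ.filter fun v => N ≤ rank l v)
    (fun v x => ∃ u ∈ Finset.univ.filter (fun u => l u < l v), Dominates x u v)
    (fun v => rank l v * (8 * (3 / 4) ^ rank l v) * W) fun v _ => h1 v
  have h3 : ∑ v ∈ Finset.univ.filter (fun v => N ≤ rank l v),
      (rank l v * (8 * (3 / 4) ^ rank l v) * W : ℝ) ≤ 80 * K * (4 / 5) ^ N * W := by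
    rw [← Finset.sum_mul]
    refine mul_le_mul_of_nonneg_right ?_ hW
    refine (hl.sum_rank_le (φ := fun r => r * (8 * (3 / 4) ^ r)) fun r => by positivity).trans ?_
    calc ∑ r ∈ Finset.Ico N (n + 1), 2 * (r : ℝ) * (r * (8 * (3 / 4) ^ r))
        ≤ ∑ r ∈ Finset.Ico N (n + 1), 16 * K * (4 / 5) ^ r :=
          Finset.sum_le_sum fun r _ => by linarith [hK r]
      _ = 16 * K * ∑ r ∈ Finset.Ico N (n + 1), (4 / 5 : ℝ) ^ r := by rw [Finset.mul_sum]
      _ ≤ 16 * K * ((4 / 5) ^ N / (1 - 4 / 5)) := by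
          have hK0 : 0 ≤ K := by simpa using hK 0
          exact mul_le_mul_of_nonneg_left (geom_sum_Ico_le_of_lt_one (by norm_num) (by norm_num))
            (by positivity)
      _ = _ := by ring
  refine le_trans (le_of_eq ?_) (h2.trans h3)
  congr 2
  ext x
  simp

open Classical in
-- With `θ = 2 * q ^ 3`, each of the `θ` vertices of the star independently has its parents in a set
-- smaller than its rank by at least `θ`. This costs `2 ^ (-θ ^ 2)` up to a factor `2 ^ θ`, against
-- at most `(3 * q ^ 6) ^ (2 * θ)` choices; `18 * q ^ 12` is `2 * (3 * q ^ 6) ^ 2`.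
theorem Tame.card_exists_star_le {q : ℕ} (hl : Tame (q ^ 6) l) (hf : Full l) (hq : 0 < q)
    (hq' : 18 * (q : ℝ) ^ 12 * (1 / 2) ^ q ≤ 1) :
    (((parentFunctions l).filter fun x => ∃ u ∈ lowVertices (q ^ 6) l,
      ∃ V ∈ (lowVertices (q ^ 6) l).powersetCard (2 * q ^ 3),
      (∀ v ∈ V, rank l u + 2 * q ^ 3 < rank l v) ∧
        ∀ v ∈ V, x v ⊆ insert u (Finset.univ.filter fun w => l w < l u)).card : ℝ) ≤
      (1 / 4) ^ q ^ 6 * (parentFunctions l).card := by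
  set W : ℝ := ((parentFunctions l).card : ℝ)
  have hW : 0 ≤ W := Nat.cast_nonneg _
  set θ := 2 * q ^ 3 with hθ
  set L := lowVertices (q ^ 6) l
  have hL : (L.card : ℝ) ≤ 3 * q ^ 6 := by exact_mod_cast hl.card_lowVertices_le hq
  have h1 : ∀ u ∈ L, ∀ V ∈ L.powersetCard θ, (((parentFunctions l).filter fun x =>
      (∀ v ∈ V, rank l u + θ < rank l v) ∧
        ∀ v ∈ V, x v ⊆ insert u (Finset.univ.filter fun w => l w < l u)).card : ℝ) ≤
      (2 / 2 ^ θ) ^ θ * W := by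
    intro u _ V hV
    by_cases hr : ∀ v ∈ V, rank l u + θ < rank l v
    · simp only [eq_true hr, true_and]
      refine le_trans (le_of_eq (by congr!)) ((card_forall_subset_le hf _ V).trans
        (mul_le_mul_of_nonneg_right ?_ hW))
      refine (Finset.prod_le_prod (g := fun _ => 2 / 2 ^ θ) (fun v _ => by positivity)
        fun v hv => ?_).trans
        (by rw [Finset.prod_const, (Finset.mem_powersetCard.1 hV).2])
      rw [div_le_div_iff₀ (by positivity) (by positivity),
        mul_assoc, ← pow_add]
      refine mul_le_mul_of_nonneg_left (pow_le_pow_right₀ one_le_two ?_) (by norm_num)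
      have h2 := Finset.card_insert_le u (Finset.univ.filter fun w => l w < l u)
      have h3 := hr v hv
      change _ ≤ rank l u + 1 at h2
      omega
    · simp only [eq_false hr, false_and, Finset.filter_false, Finset.card_empty, Nat.cast_zero]
      positivity
  have h2 : ∀ u ∈ L, (((parentFunctions l).filter fun x => ∃ V ∈ L.powersetCard θ,
      (∀ v ∈ V, rank l u + θ < rank l v) ∧
        ∀ v ∈ V, x v ⊆ insert u (Finset.univ.filter fun w => l w < l u)).card : ℝ) ≤
      (3 * q ^ 6) ^ θ * ((2 / 2 ^ θ) ^ θ * W) := by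
    intro u hu
    refine (Finset.card_filter_exists_le _ _ _ _ (h1 u hu)).trans ?_
    rw [Finset.sum_const, nsmul_eq_mul, Finset.card_powersetCard]
    refine mul_le_mul_of_nonneg_right ?_ (by positivity)
    calc ((L.card.choose θ : ℕ) : ℝ) ≤ (L.card : ℝ) ^ θ := by
          exact_mod_cast Nat.choose_le_pow _ _
      _ ≤ _ := pow_le_pow_left₀ (Nat.cast_nonneg _) hL _
  refine (Finset.card_filter_exists_le _ _ _ _ h2).trans ?_
  rw [Finset.sum_const, nsmul_eq_mul]
  have hq1 : (1 : ℝ) ≤ q := by exact_mod_cast hq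
  have hθ1 : 1 ≤ θ := by have := Nat.pow_pos hq (n := 3); omega
  have h3 : (3 * (q : ℝ) ^ 6) ≤ (3 * q ^ 6) ^ θ :=
    le_self_pow₀ (by linarith [one_le_pow₀ hq1 (n := 6)]) (by omega)
  have h4 : (18 * (q : ℝ) ^ 12) * (1 / 2) ^ q ^ 3 ≤ 1 :=
    le_trans (mul_le_mul_of_nonneg_left (pow_le_pow_of_le_one (by norm_num) (by norm_num)
      (Nat.le_self_pow (by norm_num) q)) (by positivity)) hq'
  calc (L.card : ℝ) * ((3 * q ^ 6) ^ θ * ((2 / 2 ^ θ) ^ θ * W))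
      ≤ (3 * q ^ 6) ^ θ * ((3 * q ^ 6) ^ θ * ((2 / 2 ^ θ) ^ θ * W)) :=
        mul_le_mul_of_nonneg_right (hL.trans h3) (by positivity)
    _ = (18 * q ^ 12 * (1 / 2) ^ q ^ 3 * (1 / 2) ^ q ^ 3) ^ θ * W := by
        rw [← mul_assoc, ← mul_assoc, ← mul_pow, ← mul_pow]
        congr 2
        rw [mul_assoc (18 * (q : ℝ) ^ 12), ← pow_add, ← two_mul, ← hθ, div_pow, one_pow]
        ring
    _ ≤ (1 * (1 / 2) ^ q ^ 3) ^ θ * W := by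
        refine mul_le_mul_of_nonneg_right (pow_le_pow_left₀ (by positivity) ?_ _) hW
        exact mul_le_mul_of_nonneg_right h4 (by positivity)
    _ = _ := by
        rw [one_mul, ← pow_mul, show q ^ 3 * θ = 2 * q ^ 6 by rw [hθ]; ring, pow_mul]
        norm_num

open Classical in
-- Each of the `q` independent events has probability at most `8 * (47 / 50) ^ q ^ 5`, since `3 / 4
-- ≤ (47 / 50) ^ 4`. Writing `47 / 50 = 47 / 48 * (24 / 25)`, the first factor absorbs the `(3 * q ^
-- 6) ^ (2 * q)` choices of pairs.
theorem Tame.card_exists_pairs_le {q : ℕ} (hl : Tame (q ^ 6) l) (hf : Full l) (hq : 0 < q)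
    (hq' : 72 * (q : ℝ) ^ 12 * (47 / 48) ^ q ≤ 1) :
    (((parentFunctions l).filter fun x => ∃ J ∈ (lowVertices (q ^ 6) l).powersetCard q,
      ∃ f ∈ Fintype.piFinset fun v => if v ∈ J then lowVertices (q ^ 6) l else {v},
        ((∀ v ∈ J, q ^ 5 ≤ 4 * rank l v) ∧ (∀ v ∈ J, l (f v) < l v) ∧
          ∀ v ∈ J, ∀ w ∈ J, v ≠ w → f v ≠ f w ∧ f v ≠ w) ∧
        ∀ v ∈ J, Dominates x (f v) v).card : ℝ) ≤
      (24 / 25) ^ q ^ 6 * (parentFunctions l).card := by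
  set W : ℝ := ((parentFunctions l).card : ℝ)
  have hW : 0 ≤ W := Nat.cast_nonneg _
  set L := lowVertices (q ^ 6) l
  have hL : (L.card : ℝ) ≤ 3 * q ^ 6 := by exact_mod_cast hl.card_lowVertices_le hq
  have h1 : ∀ J ∈ L.powersetCard q, ∀ f ∈ Fintype.piFinset fun v => if v ∈ J then L else {v},
      (((parentFunctions l).filter fun x =>
        ((∀ v ∈ J, q ^ 5 ≤ 4 * rank l v) ∧ (∀ v ∈ J, l (f v) < l v) ∧
          ∀ v ∈ J, ∀ w ∈ J, v ≠ w → f v ≠ f w ∧ f v ≠ w) ∧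
        ∀ v ∈ J, Dominates x (f v) v).card : ℝ) ≤ (8 * (47 / 50) ^ q ^ 5) ^ q * W := by
    intro J hJ f _
    by_cases hr : (∀ v ∈ J, q ^ 5 ≤ 4 * rank l v) ∧ (∀ v ∈ J, l (f v) < l v) ∧
          ∀ v ∈ J, ∀ w ∈ J, v ≠ w → f v ≠ f w ∧ f v ≠ w
    · simp only [eq_true hr, true_and]
      refine le_trans (le_of_eq (by congr!)) ((card_forall_dominates_le hf f J hr.2.1 hr.2.2).trans
        (mul_le_mul_of_nonneg_right ?_ hW))
      refine (Finset.prod_le_prod (g := fun _ => 8 * (47 / 50) ^ q ^ 5) (fun v _ => by positivity)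
        fun v hv => ?_).trans
        (by rw [Finset.prod_const, (Finset.mem_powersetCard.1 hJ).2])
      refine mul_le_mul_of_nonneg_left ?_ (by norm_num)
      calc (3 / 4 : ℝ) ^ rank l v ≤ ((47 / 50) ^ 4) ^ rank l v :=
            pow_le_pow_left₀ (by norm_num) (by norm_num) _
        _ = (47 / 50) ^ (4 * rank l v) := by rw [pow_mul]
        _ ≤ _ := pow_le_pow_of_le_one (by norm_num) (by norm_num) (hr.1 v hv)
    · simp only [eq_false hr, false_and, Finset.filter_false, Finset.card_empty, Nat.cast_zero]
      positivity
  have h2 : ∀ J ∈ L.powersetCard q, (((parentFunctions l).filter fun x =>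
      ∃ f ∈ Fintype.piFinset fun v => if v ∈ J then L else {v},
        ((∀ v ∈ J, q ^ 5 ≤ 4 * rank l v) ∧ (∀ v ∈ J, l (f v) < l v) ∧
          ∀ v ∈ J, ∀ w ∈ J, v ≠ w → f v ≠ f w ∧ f v ≠ w) ∧
        ∀ v ∈ J, Dominates x (f v) v).card : ℝ) ≤
      (3 * q ^ 6) ^ q * ((8 * (47 / 50) ^ q ^ 5) ^ q * W) := by
    intro J hJ
    refine (Finset.card_filter_exists_le _ _ _ _ (h1 J hJ)).trans ?_
    rw [Finset.sum_const, nsmul_eq_mul, Fintype.card_piFinset]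
    refine mul_le_mul_of_nonneg_right ?_ (by positivity)
    have h3 : ∏ v, (if v ∈ J then L else {v}).card = L.card ^ q := by
      rw [← (Finset.mem_powersetCard.1 hJ).2, ← Finset.prod_const, ← Finset.univ_inter J,
        ← Finset.prod_ite_mem, Finset.univ_inter]
      exact Finset.prod_congr rfl fun v _ => by split_ifs <;> simp
    rw [h3]
    push_cast
    exact pow_le_pow_left₀ (Nat.cast_nonneg _) hL _
  refine (Finset.card_filter_exists_le _ _ _ _ h2).trans ?_
  rw [Finset.sum_const, nsmul_eq_mul, Finset.card_powersetCard]
  have h4 : (72 * (q : ℝ) ^ 12) * (47 / 48) ^ q ^ 5 ≤ 1 :=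
    le_trans (mul_le_mul_of_nonneg_left (pow_le_pow_of_le_one (by norm_num) (by norm_num)
      (Nat.le_self_pow (by norm_num) q)) (by positivity)) hq'
  calc ((L.card.choose q : ℕ) : ℝ) * ((3 * q ^ 6) ^ q * ((8 * (47 / 50) ^ q ^ 5) ^ q * W))
      ≤ (3 * q ^ 6) ^ q * ((3 * q ^ 6) ^ q * ((8 * (47 / 50) ^ q ^ 5) ^ q * W)) := by
        refine mul_le_mul_of_nonneg_right ?_ (by positivity)
        calc ((L.card.choose q : ℕ) : ℝ) ≤ (L.card : ℝ) ^ q := by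
              exact_mod_cast Nat.choose_le_pow _ _
          _ ≤ _ := pow_le_pow_left₀ (Nat.cast_nonneg _) hL _
    _ = (72 * q ^ 12 * (47 / 48) ^ q ^ 5 * (24 / 25) ^ q ^ 5) ^ q * W := by
        rw [← mul_assoc, ← mul_assoc, ← mul_pow, ← mul_pow]
        congr 2
        rw [mul_assoc (72 * (q : ℝ) ^ 12), ← mul_pow]
        norm_num
        ring
    _ ≤ (1 * (24 / 25) ^ q ^ 5) ^ q * W := by
        refine mul_le_mul_of_nonneg_right (pow_le_pow_left₀ (by positivity) ?_ _) hW
        exact mul_le_mul_of_nonneg_right h4 (by positivity)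
    _ = _ := by rw [one_mul, ← pow_mul, ← pow_succ]

open Classical in
theorem exists_card_dominatedSet_le :
    ∃ C : ℝ, 0 < C ∧ ∃ q₀ : ℕ, ∀ q ≥ q₀, ∀ (n : ℕ) (l : Fin n → ℕ), Full l → Tame (q ^ 6) l →
      (((parentFunctions l).filter fun x => q ^ 5 ≤ (dominatedSet x).card).card : ℝ) ≤
        C * (24 / 25) ^ q ^ 6 * (parentFunctions l).card := by
  obtain ⟨K, hK0, hK⟩ := exists_forall_sq_mul_pow_le
  obtain ⟨q₁, hq₁⟩ := exists_forall_const_mul_pow_le 18 (1 / 2) (by norm_num) (by norm_num)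
  obtain ⟨q₂, hq₂⟩ := exists_forall_const_mul_pow_le 72 (47 / 48) (by norm_num) (by norm_num)
  refine ⟨80 * K + 1 + 1, by positivity, max 20 (max q₁ q₂), fun q hq n l hf hl => ?_⟩
  have hq20 : 20 ≤ q := (le_max_left _ _).trans hq
  have h1 := hl.card_exists_high_le hK hf
  have h2 := hl.card_exists_star_le hf (by omega)
    (hq₁ q ((le_max_left _ _).trans ((le_max_right _ _).trans hq)))
  have h3 := hl.card_exists_pairs_le hf (by omega)
    (hq₂ q ((le_max_right _ _).trans ((le_max_right _ _).trans hq)))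
  have hW : (0 : ℝ) ≤ (parentFunctions l).card := Nat.cast_nonneg _
  have h4 : (4 / 5 : ℝ) ^ q ^ 6 ≤ (24 / 25) ^ q ^ 6 :=
    pow_le_pow_left₀ (by norm_num) (by norm_num) _
  have h5 : (1 / 4 : ℝ) ^ q ^ 6 ≤ (24 / 25) ^ q ^ 6 :=
    pow_le_pow_left₀ (by norm_num) (by norm_num) _
  have h6 := mul_le_mul_of_nonneg_right (mul_le_mul_of_nonneg_left h4
    (by positivity : 0 ≤ 80 * K)) hW
  have h7 := mul_le_mul_of_nonneg_right h5 hW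
  refine (Finset.card_filter_le_of_imp_or (h1.trans h6) (h2.trans h7) h3
    fun x hxl hx => ?_).trans (le_of_eq (by ring))
  exact hl.exists_of_le_card_dominatedSet hq20
    (fun v => (mem_parentSets.1 (Fintype.mem_piFinset.1 hxl v)).1) hx

end LabeledDAG

/-! ### Averaging over height functions -/

namespace LabeledDAG

open Classical in
-- Law of total probability: a bound uniform over the admissible height functions passes to the
-- uniform DAG.
theorem card_height_parents_le {n : ℕ} (P : (Fin n → ℕ) → Prop)
    (Q : (Fin n → Finset (Fin n)) → Prop) (c : ℝ)
    (h : ∀ l, P l → (((parentFunctions l).filter Q).card : ℝ) ≤ c * (parentFunctions l).card)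
    (hc : 0 ≤ c) :
    ((Finset.univ.filter fun G : LabeledDAG n => P G.height ∧ Q G.parents).card : ℝ) ≤
      c * Fintype.card (LabeledDAG n) := by
  have h1 : ∀ s : Finset (LabeledDAG n), s.card =
      ∑ l ∈ Finset.univ.image (height (n := n)), (s.filter fun G => G.height = l).card :=
    fun s => Finset.card_eq_sum_card_fiberwise fun G _ =>
      Finset.mem_image_of_mem _ (Finset.mem_univ G)
  rw [h1, ← Finset.card_univ, h1 Finset.univ]
  push_cast
  rw [Finset.mul_sum]
  refine Finset.sum_le_sum fun l _ => ?_
  rw [card_height_eq]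
  by_cases hP : P l
  · refine le_trans (Nat.cast_le.2 (le_of_eq ?_)) (h l hP)
    rw [← card_filter_height_eq]
    congr 1
    ext G
    simp only [Finset.mem_filter, Finset.mem_univ, true_and]
    constructor
    · rintro ⟨⟨-, h⟩, h'⟩
      exact ⟨h', h⟩
    · rintro ⟨rfl, h⟩
      exact ⟨⟨hP, h⟩, rfl⟩
  · rw [Finset.filter_false_of_mem, Finset.card_empty, Nat.cast_zero]
    · positivity
    · intro G hG e
      exact hP (e ▸ (Finset.mem_filter.1 hG).2.1)

theorem full_height {n : ℕ} (G : LabeledDAG n) : Full G.height :=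
  fun _ _ h => layer_height_pos G h.le

open Classical in
/-- The height function of a uniform DAG is tame up to an exponentially small probability. -/
theorem card_not_tame_le (n N : ℕ) :
    ((Finset.univ.filter fun G : LabeledDAG n => ¬ Tame N G.height).card : ℝ) ≤
      2 ^ 18 * 25 * (24 / 25) ^ N * Fintype.card (LabeledDAG n) := by
  set D : ℝ := (Fintype.card (LabeledDAG n) : ℝ)
  have hD : 0 ≤ D := Nat.cast_nonneg _
  have h1 : ∀ i ∈ Finset.range (n + 1), ((Finset.univ.filter fun G : LabeledDAG n =>
      N + i < layer G.height i ^ 2).card : ℝ) ≤ 2 ^ 18 * (24 / 25) ^ (N + i) * D := by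
    intro i _
    have h2 := card_le_layer_le n (Nat.sqrt (N + i) + 1) i
    have h3 : ∀ G : LabeledDAG n,
        (N + i < layer G.height i ^ 2) = (Nat.sqrt (N + i) + 1 ≤ layer G.height i) := fun G => by
      rw [Nat.succ_le_iff, Nat.sqrt_lt']
    simp_rw [h3]
    refine le_trans (le_of_eq (by congr!)) (h2.trans ?_)
    refine mul_le_mul_of_nonneg_right (mul_le_mul_of_nonneg_left ?_ (by norm_num)) hD
    exact pow_le_pow_of_le_one (by norm_num) (by norm_num) (Nat.lt_succ_sqrt' _).le
  have h2 := Finset.card_filter_exists_le Finset.univ (Finset.range (n + 1))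
    (fun i (G : LabeledDAG n) => N + i < layer G.height i ^ 2) _ h1
  have h3 : ∑ i ∈ Finset.range (n + 1), (24 / 25 : ℝ) ^ (N + i) ≤ 25 * (24 / 25) ^ N := by
    simp_rw [pow_add]
    rw [← Finset.mul_sum, mul_comm]
    refine mul_le_mul_of_nonneg_right ?_ (by positivity)
    rw [Finset.range_eq_Ico]
    refine (geom_sum_Ico_le_of_lt_one (by norm_num) (by norm_num)).trans (by norm_num)
  calc _ ≤ _ := Nat.cast_le.2 (Finset.card_le_card ?_)
    _ ≤ _ := h2
    _ = 2 ^ 18 * (∑ i ∈ Finset.range (n + 1), (24 / 25 : ℝ) ^ (N + i)) * D := by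
      rw [Finset.mul_sum, Finset.sum_mul]
    _ ≤ 2 ^ 18 * (25 * (24 / 25) ^ N) * D :=
      mul_le_mul_of_nonneg_right (mul_le_mul_of_nonneg_left h3 (by norm_num)) hD
    _ = _ := by ring
  intro G hG
  simp only [Finset.mem_filter, Finset.mem_univ, true_and, Tame, not_forall, not_le] at hG ⊢
  obtain ⟨v, hv⟩ := hG
  -- All lower levels are occupied, so the threshold N + rank may be weakened to N + height, and the
  -- union runs over levels.
  have h4 : G.height v ≤ rank G.height v := le_cumul (full_height G v)
  have h5 : rank G.height v ≤ n := by
    change cumul G.height (G.height v) ≤ n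
    exact (Finset.card_le_univ _).trans (Fintype.card_fin n).le
  exact ⟨G.height v, Finset.mem_range.2 (by omega), by omega⟩

open Classical in
theorem exists_card_dominatedVertices_le :
    ∃ C : ℝ, 0 < C ∧ ∃ q₀ : ℕ, ∀ q ≥ q₀, ∀ n : ℕ,
      ((Finset.univ.filter fun G : LabeledDAG n => q ^ 5 ≤ G.dominatedVertices.ncard).card : ℝ) ≤
        C * (24 / 25) ^ q ^ 6 * Fintype.card (LabeledDAG n) := by
  obtain ⟨C, hC, q₀, h⟩ := exists_card_dominatedSet_le
  refine ⟨2 ^ 18 * 25 + C, by positivity, q₀, fun q hq n => ?_⟩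
  have h1 := card_not_tame_le n (q ^ 6)
  have h2 := card_height_parents_le (n := n) (fun l => Full l ∧ Tame (q ^ 6) l)
    (fun x => q ^ 5 ≤ (dominatedSet x).card) (C * (24 / 25) ^ q ^ 6)
    (fun l hl => le_trans (le_of_eq (by congr!)) (h q hq n l hl.1 hl.2)) (by positivity)
  have h3 : (Finset.univ.filter fun G : LabeledDAG n => q ^ 5 ≤ G.dominatedVertices.ncard) ⊆
      (Finset.univ.filter fun G : LabeledDAG n => ¬ Tame (q ^ 6) G.height) ∪
        Finset.univ.filter fun G : LabeledDAG n => (Full G.height ∧ Tame (q ^ 6) G.height) ∧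
          q ^ 5 ≤ (dominatedSet G.parents).card := by
    intro G hG
    simp only [Finset.mem_union, Finset.mem_filter, Finset.mem_univ, true_and,
      card_dominatedSet] at hG ⊢
    have := full_height G
    tauto
  have h4 := Nat.cast_le (α := ℝ) |>.2 ((Finset.card_le_card h3).trans (Finset.card_union_le _ _))
  push_cast at h4
  exact (h4.trans (add_le_add (le_trans (le_of_eq (by congr!)) h1)
    (le_trans (le_of_eq (by congr!)) h2))).trans (le_of_eq (by ring))

/-! ### From dominated vertices to tails and moments of the class size -/

open Classical in
theorem real_uniformLaw {n : ℕ} (p : LabeledDAG n → Prop) :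
    (uniformLaw n).real {G | p G} =
      (Finset.univ.filter p).card / Fintype.card (LabeledDAG n) := by
  rw [MeasureTheory.measureReal_def, uniformLaw,
    PMF.toMeasure_uniformOfFintype_apply _ (MeasurableSet.of_discrete), ENNReal.toReal_div,
    ENNReal.toReal_natCast, ENNReal.toReal_natCast]
  congr 2
  rw [Fintype.card_subtype]
  rfl

/-- A bound for the size of the Markov equivalence class of a DAG with at most `q ^ 5` dominated
vertices. -/
def sizeBound (q : ℕ) : ℕ := (2 * q ^ 5) ^ (2 * q ^ 5)

theorem le_sizeBound (q : ℕ) : q ≤ sizeBound q := by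
  rcases Nat.eq_zero_or_pos q with rfl | h
  · exact Nat.zero_le _
  · have h1 : q ≤ q ^ 5 := Nat.le_self_pow (by norm_num) q
    exact (by omega : q ≤ 2 * q ^ 5).trans (Nat.le_self_pow (by omega) _)

theorem exists_measure_sizeBound_le :
    ∃ C : ℝ, 0 < C ∧ ∃ q₀ : ℕ, ∀ q ≥ q₀, ∀ n : ℕ,
      (uniformLaw n).real {G : LabeledDAG n | sizeBound q < G.mecSize} ≤
        C * (24 / 25) ^ q ^ 6 := by
  classical
  obtain ⟨C, hC, q₀, h⟩ := exists_card_dominatedVertices_le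
  refine ⟨C, hC, max q₀ 1, fun q hq n => ?_⟩
  have hq1 : 1 ≤ q := (le_max_right _ _).trans hq
  have h1 := h q ((le_max_left _ _).trans hq) n
  rw [real_uniformLaw, div_le_iff₀ (by exact_mod_cast Fintype.card_pos)]
  refine le_trans (Nat.cast_le.2 (Finset.card_le_card fun G hG => ?_)) h1
  simp only [Finset.mem_filter, Finset.mem_univ, true_and] at hG ⊢
  by_contra! hlt
  refine absurd hG (not_lt.2 (G.mecSize_le_pow.trans ?_))
  have h2 : 1 ≤ q ^ 5 := Nat.one_le_pow _ _ hq1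
  exact (Nat.pow_le_pow_left (by omega) _).trans (Nat.pow_le_pow_right (by omega) (by omega))

/-- The logarithm of `y` is absorbed into `√y`, which raises the exponent from 5 to 11/2. -/
theorem log_sizeBound_le {y : ℕ} (hy : 1 ≤ y) :
    Real.log (sizeBound y) ≤ 24 * (y : ℝ) ^ (11 / 2 : ℝ) := by
  have hy' : (1 : ℝ) ≤ y := by exact_mod_cast hy
  have h1 : Real.log (sizeBound y) = 2 * y ^ 5 * (Real.log 2 + 5 * Real.log y) := by
    rw [sizeBound]
    push_cast
    rw [Real.log_pow, Real.log_mul (by norm_num) (by positivity), Real.log_pow]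
    push_cast
    ring
  have h2 : Real.log y ≤ 2 * (y : ℝ) ^ (1 / 2 : ℝ) := by
    have := Real.log_le_rpow_div (zero_le_one.trans hy') (ε := 1 / 2) (by norm_num)
    linarith
  have h3 : (1 : ℝ) ≤ (y : ℝ) ^ (1 / 2 : ℝ) := Real.one_le_rpow hy' (by norm_num)
  have h4 : Real.log 2 ≤ 1 := by
    have := Real.log_two_lt_d9
    linarith
  have h5 : (y : ℝ) ^ (11 / 2 : ℝ) = y ^ 5 * (y : ℝ) ^ (1 / 2 : ℝ) := by
    rw [← Real.rpow_natCast, ← Real.rpow_add (by linarith)]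
    norm_num
  rw [h1, h5]
  have h6 : Real.log 2 + 5 * Real.log y ≤ 11 * (y : ℝ) ^ (1 / 2 : ℝ) := by linarith
  have h7 := mul_le_mul_of_nonneg_left h6 (by positivity : (0 : ℝ) ≤ 2 * y ^ 5)
  have h8 : (0 : ℝ) ≤ y ^ 5 * (y : ℝ) ^ (1 / 2 : ℝ) := by positivity
  linarith

/-- The point is 11/2 · 21/20 = 231/40 < 6. The spare power 9/40 absorbs the constants: `A`, 64 from
`q + 1 ≤ 2 * q`, and 25 from `24 / 25 ≤ exp (-1 / 25)`. The right-hand side is taken at `q + 1`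
because `t` will lie between two consecutive size bounds. -/
theorem exists_pow_le_exp_log_sizeBound :
    ∃ q₁ : ℕ, ∀ q ≥ q₁, ((24 : ℝ) / 25) ^ q ^ 6 ≤
      Real.exp (-(Real.log (sizeBound (q + 1)) ^ (1 + 1 / 20 : ℝ))) := by
  set A : ℝ := 24 ^ (1 + 1 / 20 : ℝ)
  have hA : 0 < A := by positivity
  have h := (tendsto_rpow_atTop (y := (9 / 40 : ℝ)) (by norm_num)).comp
    (tendsto_natCast_atTop_atTop (R := ℝ))
  obtain ⟨q₁, hq₁⟩ := Filter.eventually_atTop.1 (h.eventually_ge_atTop (A * 64 * 25))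
  refine ⟨max q₁ 1, fun q hq => ?_⟩
  have hq1 : 1 ≤ q := (le_max_right _ _).trans hq
  have hq1' : (1 : ℝ) ≤ q := by exact_mod_cast hq1
  have h1 : A * 64 * 25 ≤ ((q + 1 : ℕ) : ℝ) ^ (9 / 40 : ℝ) :=
    hq₁ (q + 1) (((le_max_left _ _).trans hq).trans (Nat.le_succ q))
  set y : ℝ := ((q + 1 : ℕ) : ℝ) with hy
  have hy1 : 1 ≤ y := by rw [hy]; push_cast; linarith
  have hlog0 : 0 ≤ Real.log (sizeBound (q + 1)) := Real.log_natCast_nonneg _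
  have h2 : Real.log (sizeBound (q + 1)) ^ (1 + 1 / 20 : ℝ) ≤ A * y ^ (231 / 40 : ℝ) := by
    refine (Real.rpow_le_rpow hlog0 (log_sizeBound_le (Nat.le_add_left 1 q)) (by norm_num)).trans ?_
    rw [Real.mul_rpow (by norm_num) (by positivity), ← Real.rpow_mul (by linarith)]
    rw [show (11 / 2 * (1 + 1 / 20) : ℝ) = 231 / 40 by norm_num]
  have h3 : y ^ (231 / 40 : ℝ) * y ^ (9 / 40 : ℝ) = y ^ 6 := by
    rw [← Real.rpow_add (by linarith), ← Real.rpow_natCast]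
    norm_num
  have h4 : y ^ 6 ≤ 64 * q ^ 6 := by
    calc y ^ 6 ≤ (2 * q) ^ 6 := pow_le_pow_left₀ (by linarith)
          (by rw [hy]; push_cast; linarith) 6
      _ = _ := by ring
  have h5 : A * y ^ (231 / 40 : ℝ) ≤ q ^ 6 / 25 := by
    have h6 := mul_le_mul_of_nonneg_left h1 (by positivity : 0 ≤ y ^ (231 / 40 : ℝ))
    rw [h3] at h6
    linarith
  have h7 : (24 / 25 : ℝ) ≤ Real.exp (-(1 / 25)) := by
    have := Real.add_one_le_exp (-(1 / 25 : ℝ))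
    linarith
  calc ((24 : ℝ) / 25) ^ q ^ 6 ≤ Real.exp (-(1 / 25)) ^ q ^ 6 :=
        pow_le_pow_left₀ (by norm_num) h7 _
    _ = Real.exp (-(q ^ 6 / 25)) := by
        rw [← Real.exp_nat_mul]
        push_cast
        ring_nf
    _ ≤ _ := Real.exp_le_exp.2 (by linarith)

theorem exists_measure_mecSize_gt_le :
    ∃ C : ℝ, 0 < C ∧ ∃ t₀ : ℝ, 1 ≤ t₀ ∧ ∀ n : ℕ, ∀ t : ℝ, t₀ ≤ t →
      (uniformLaw n).real {G : LabeledDAG n | t < (G.mecSize : ℝ)} ≤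
        C * Real.exp (-(Real.log t ^ (1 + 1 / 20 : ℝ))) := by
  obtain ⟨C, hC, q₀, h⟩ := exists_measure_sizeBound_le
  obtain ⟨q₁, h'⟩ := exists_pow_le_exp_log_sizeBound
  set Q := max (max q₀ q₁) 1
  have hQ1 : 1 ≤ Q := le_max_right _ _
  refine ⟨C, hC, sizeBound Q, by exact_mod_cast hQ1.trans (le_sizeBound Q), fun n t ht => ?_⟩
  have hex : ∃ k, t < sizeBound (Q + k) := by
    obtain ⟨k, hk⟩ := exists_nat_gt t
    refine ⟨k, hk.trans_le ?_⟩
    exact_mod_cast (Nat.le_add_left k Q).trans (le_sizeBound _)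
  classical
  -- The first size bound exceeding t is not the one at Q, as t is at least that; so t lies between
  -- the bounds at Q + k and Q + k + 1.
  obtain ⟨k, hk⟩ : ∃ k, Nat.find hex = k + 1 := by
    refine ⟨Nat.find hex - 1, ?_⟩
    have : Nat.find hex ≠ 0 := by
      intro h0
      have := Nat.find_spec hex
      rw [h0] at this
      exact absurd ht (not_le.2 this)
    omega
  have h1 : (sizeBound (Q + k) : ℝ) ≤ t := not_lt.1 (Nat.find_min hex (m := k) (by omega))
  have h2 : t < sizeBound (Q + k + 1) := by
    have := Nat.find_spec hex
    rwa [hk, ← add_assoc] at this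
  have ht1 : 1 ≤ t := by
    refine le_trans ?_ ht
    exact_mod_cast hQ1.trans (le_sizeBound Q)
  have hQ0 : q₀ ≤ Q + k := ((le_max_left _ _).trans (le_max_left _ _)).trans (Nat.le_add_right _ _)
  have hQ1 : q₁ ≤ Q + k := ((le_max_right _ _).trans (le_max_left _ _)).trans (Nat.le_add_right _ _)
  calc (uniformLaw n).real {G : LabeledDAG n | t < (G.mecSize : ℝ)}
      ≤ (uniformLaw n).real {G : LabeledDAG n | sizeBound (Q + k) < G.mecSize} := by
        refine MeasureTheory.measureReal_mono fun G hG => ?_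
        exact Nat.cast_lt.1 (h1.trans_lt hG)
    _ ≤ C * (24 / 25) ^ (Q + k) ^ 6 := h _ hQ0 n
    _ ≤ C * Real.exp (-(Real.log (sizeBound (Q + k + 1)) ^ (1 + 1 / 20 : ℝ))) :=
        mul_le_mul_of_nonneg_left (h' _ hQ1) hC.le
    _ ≤ _ := by
        refine mul_le_mul_of_nonneg_left (Real.exp_le_exp.2 (neg_le_neg ?_)) hC.le
        exact Real.rpow_le_rpow (Real.log_nonneg ht1)
          (Real.log_le_log (by linarith) h2.le) (by norm_num)

/-- The exponent exceeds 1, and `(log j) ^ (1 / 20)` eventually exceeds `k`. -/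
theorem exists_forall_exp_log_rpow_le (k : ℕ) :
    ∃ J : ℕ, 1 ≤ J ∧ ∀ j ≥ J,
      Real.exp (-(Real.log (j : ℝ) ^ (1 + 1 / 20 : ℝ))) ≤ ((j : ℝ) ^ k)⁻¹ := by
  have h := (tendsto_rpow_atTop (y := (1 / 20 : ℝ)) (by norm_num)).comp
    (Real.tendsto_log_atTop.comp (tendsto_natCast_atTop_atTop (R := ℝ)))
  obtain ⟨J, hJ⟩ := Filter.eventually_atTop.1 (h.eventually_ge_atTop (k : ℝ))
  refine ⟨max J 2, by omega, fun j hj => ?_⟩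
  have h1 : (k : ℝ) ≤ Real.log j ^ (1 / 20 : ℝ) := hJ j ((le_max_left _ _).trans hj)
  have hj2 : (2 : ℝ) ≤ j := by exact_mod_cast (le_max_right _ _).trans hj
  have hlog : 0 < Real.log j := Real.log_pos (by linarith)
  rw [Real.rpow_add hlog, Real.rpow_one, Real.exp_neg]
  refine inv_anti₀ (by positivity) ?_
  calc (j : ℝ) ^ k = Real.exp (Real.log j * k) := by
        rw [mul_comm, Real.exp_nat_mul, Real.exp_log (by linarith)]
    _ ≤ _ := Real.exp_le_exp.2 (mul_le_mul_of_nonneg_left h1 hlog.le)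

theorem integral_pow_le_sum {n : ℕ} (X : LabeledDAG n → ℕ) (k : ℕ) :
    ∃ B : ℕ, ∫ G, (X G : ℝ) ^ k ∂(uniformLaw n) ≤
      1 + ∑ j ∈ Finset.range B, ((j : ℝ) + 1) ^ k *
        (uniformLaw n).real {G | (j : ℝ) < X G} := by
  classical
  -- The sum of all values bounds each of them. When X G > 0, the single term j = X G - 1 already
  -- accounts for X G ^ k; the leading 1 covers X G = 0, including k = 0.
  refine ⟨∑ G, X G, ?_⟩
  have h1 : ∀ G, (X G : ℝ) ^ k ≤ 1 + ∑ j ∈ Finset.range (∑ G, X G), ((j : ℝ) + 1) ^ k *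
      Set.indicator {G | (j : ℝ) < X G} 1 G := by
    intro G
    have hnn : ∀ j ∈ Finset.range (∑ G, X G), 0 ≤ ((j : ℝ) + 1) ^ k *
        Set.indicator {G | (j : ℝ) < X G} (1 : LabeledDAG n → ℝ) G := fun j _ =>
      mul_nonneg (by positivity) (Set.indicator_nonneg (fun _ _ => zero_le_one) _)
    rcases Nat.eq_zero_or_pos (X G) with h0 | h0
    · have h2 : (X G : ℝ) ^ k ≤ 1 := by
        rw [h0]
        exact pow_le_one₀ (by simp) (by simp)
      linarith [Finset.sum_nonneg hnn]
    · have hmem : X G - 1 ∈ Finset.range (∑ G, X G) := by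
        have := Finset.single_le_sum (f := X) (fun _ _ => Nat.zero_le _) (Finset.mem_univ G)
        rw [Finset.mem_range]
        omega
      have h2 := Finset.single_le_sum hnn hmem
      have h3 : ((X G - 1 : ℕ) : ℝ) + 1 = X G := by
        rw [Nat.cast_sub h0]
        simp
      have h4 : G ∈ {H | ((X G - 1 : ℕ) : ℝ) < X H} := by
        change ((X G - 1 : ℕ) : ℝ) < X G
        exact_mod_cast Nat.sub_lt h0 one_pos
      rw [Set.indicator_of_mem h4, h3] at h2
      simp only [Pi.one_apply, mul_one] at h2
      linarith
  have hint : ∀ f : LabeledDAG n → ℝ, MeasureTheory.Integrable f (uniformLaw n) := fun f =>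
    MeasureTheory.Integrable.of_finite
  refine (MeasureTheory.integral_mono (hint _) (hint _) h1).trans (le_of_eq ?_)
  rw [MeasureTheory.integral_add (hint _) (hint _),
    MeasureTheory.integral_finsetSum _ fun _ _ => hint _]
  congr 1
  · simp
  · refine Finset.sum_congr rfl fun j _ => ?_
    rw [MeasureTheory.integral_const_mul, MeasureTheory.integral_indicator_one]
    exact MeasurableSet.of_discrete

theorem exists_integral_mecSize_pow_le (k : ℕ) : ∃ c : ℝ, 0 < c ∧ ∀ n : ℕ,
    ∫ G : LabeledDAG n, (G.mecSize : ℝ) ^ k ∂(uniformLaw n) ≤ c := by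
  obtain ⟨C, hC, t₀, ht₀, h⟩ := exists_measure_mecSize_gt_le
  -- Two powers more than k leave the summable tail 1 / j ^ 2.
  obtain ⟨J, hJ1, hJ⟩ := exists_forall_exp_log_rpow_le (k + 2)
  set J' := max J ⌈t₀⌉₊
  -- Below J' the probability is bounded by 1. As J' ≥ 1, this covers j = 0, where 1 / j ^ 2 takes
  -- the default value 0.
  set a : ℕ → ℝ := fun j => (if j < J' then ((j : ℝ) + 1) ^ k else 0) + C * 2 ^ k * (1 / j ^ 2)
  have ha0 : ∀ j, 0 ≤ a j := fun j => by
    refine add_nonneg ?_ (by positivity)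
    split_ifs <;> positivity
  have ha : Summable a := by
    refine Summable.add ?_ ((Real.summable_one_div_nat_pow.2 (by norm_num)).mul_left _)
    refine summable_of_ne_finset_zero (s := Finset.range J') fun j hj => ?_
    rw [if_neg (by simpa using hj)]
  refine ⟨1 + ∑' j, a j, by have : 0 ≤ ∑' j, a j := tsum_nonneg ha0; linarith, fun n => ?_⟩
  obtain ⟨B, hB⟩ := integral_pow_le_sum (mecSize (n := n)) k
  refine hB.trans (add_le_add le_rfl ((Finset.sum_le_sum fun j _ => ?_).trans
    (ha.sum_le_tsum (Finset.range B) fun j _ => ha0 j)))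
  by_cases hj : j < J'
  · simp only [a, if_pos hj]
    have h1 : (uniformLaw n).real {G : LabeledDAG n | (j : ℝ) < G.mecSize} ≤ 1 :=
      MeasureTheory.measureReal_le_one
    have h2 : (0 : ℝ) ≤ C * 2 ^ k * (1 / j ^ 2) := by positivity
    have h3 := mul_le_mul_of_nonneg_left h1 (by positivity : (0 : ℝ) ≤ ((j : ℝ) + 1) ^ k)
    linarith
  · simp only [a, if_neg hj, zero_add]
    push Not at hj
    have hjJ : J ≤ j := (le_max_left _ _).trans hj
    have hjt : t₀ ≤ j := (Nat.le_ceil t₀).trans (by exact_mod_cast (le_max_right _ _).trans hj)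
    have hj1 : (1 : ℝ) ≤ j := by exact_mod_cast hJ1.trans hjJ
    have h1 := (h n j hjt).trans (mul_le_mul_of_nonneg_left (hJ j hjJ) hC.le)
    have h2 : ((j : ℝ) + 1) ^ k ≤ 2 ^ k * j ^ k := by
      rw [← mul_pow]
      exact pow_le_pow_left₀ (by positivity) (by linarith) k
    calc _ ≤ (2 ^ k * (j : ℝ) ^ k) * (C * ((j : ℝ) ^ (k + 2))⁻¹) :=
          mul_le_mul h2 h1 MeasureTheory.measureReal_nonneg (by positivity)
      _ = _ := by
          rw [pow_add]
          field_simp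

end LabeledDAG

theorem theorem1p1 :
    (∃ C : ℝ, 0 < C ∧ ∃ t₀ : ℝ, 1 ≤ t₀ ∧ ∀ n : ℕ, ∀ t : ℝ, t₀ ≤ t →
      (LabeledDAG.uniformLaw n).real {G : LabeledDAG n | t < (G.mecSize : ℝ)} ≤
        C * Real.exp (-(Real.log t ^ (1 + 1 / 20 : ℝ)))) ∧
    (∀ k : ℕ, ∃ c : ℝ, 0 < c ∧ ∀ n : ℕ,
      ∫ G : LabeledDAG n, (G.mecSize : ℝ) ^ k ∂(LabeledDAG.uniformLaw n) ≤ c) ∧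
    (∃ c : ℝ, 0 < c ∧ ∀ n : ℕ,
      ∫ G : LabeledDAG n, (G.mecSize : ℝ) ∂(LabeledDAG.uniformLaw n) ≤ c) := by
  refine ⟨LabeledDAG.exists_measure_mecSize_gt_le, LabeledDAG.exists_integral_mecSize_pow_le, ?_⟩
  simpa only [pow_one] using LabeledDAG.exists_integral_mecSize_pow_le 1
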